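/- Let $N\ge 1$ and let $\Omega\subset\mathbb R^N$ be a bounded open set. Let $h\in C((0,\infty))\cap L^1_{loc}([0,\infty))$ with $h>0$ on $(0,\infty)$, let $H(v)=\int_0^v h(r)\,dr$ for $v\ge 0$, and let $F:[0,\infty)\to\mathbb R$ be locally Lipschitz and nondecreasing. Let $\gamma_1>0$ and assume: (i) $H^{\gamma_1+1}\in C^1([0,\infty))$, and for every $M>0$ there is $c_1(M)>0$ with $[H^{\gamma_1+1}]'(s)\le c_1(M)$ for all $s\in[0,M]$; (ii) for every $M>0$ there is $c_2(M)>0$ such that $FH^{\gamma_1+1}$ is differentiable on $[0,M]$ with $[FH^{\gamma_1+1}]'(s)\ge c_2(M)$ for all $s\in[0,M]$ (derivatives at $0$ are one-sided). For $t_0,M\in\mathbb R$, a *bounded nonnegative solution with bound $M$* of $$[H(u)]_t-F(u)\Delta u\le 0\ \text{ in }\Omega\times(t_0,\infty),\qquad u(\cdot,t_0)=u_0\ \text{ on }\Omega,\qquad u=0\ \text{ on }\partial\Omega\times(t_0,\infty)$$ is a measurable function $u\ge 0$ with $u\le M$ on $\Omega\times(t_0,\infty)$ and $u(\cdot,t_0)=u_0$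 a.e. in $\Omega$, such that $[H(u)]_t$ exists in $L^2(\Omega\times(t_0,\infty))$, meaning that there is $w\in L^2(\Omega\times(t_0,\infty))$ with $H(u(\cdot,t))=H(u(\cdot,t_0))+\int_{t_0}^t w(\cdot,s)\,ds$ a.e. in $\Omega$ for every $t\ge t_0$, and such that for a.e. $t>t_0$: $u(\cdot,t)\in W^{1,2}_0(\Omega)$, its weak Laplacian $\Delta u(\cdot,t)$ exists in $L^1_{loc}(\Omega)$, $F(u)\Delta u\in L^2(\Omega)$, and $[H(u)]_t-F(u)\Delta u\le 0$ a.e. in $\Omega$. Let $p\ge\gamma_1+1$ and $M\in\mathbb R$. Then there is a constant $c>0$, depending on $M$ (and on $\Omega,h,F,\gamma_1,p$) but not on $t_0,u_0,u$, such that for every bounded nonnegative solution $u$ with bound $M$ the function $$Y(t)=\int_\Omega [H(u(x,t))]^{p+1}\,dx,\qquad t\ge t_0,$$ is finite, is absolutely continuous on every interval $[t_0,T]$, hence differentiable at almost every $t>t_0$, and satisfies $$Y'(t)+c\,[Y(t)]^{\frac{p+1+\gamma_1}{p+1}}\le 0$$ at every $t>t_0$ at which $Y$ is differentiable. If $Y_0:=Y(t_0)=0$,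 then $Y(t)=0$ for all $t\ge t_0$. If $Y_0>0$, then $$Y(t)\le\Big[c\,\tfrac{\gamma_1}{p+1}(t-t_0)+Y_0^{-\frac{\gamma_1}{p+1}}\Big]^{-\frac{p+1}{\gamma_1}}\qquad\text{for all }t\ge t_0.$$ In particular $\lim_{t\to\infty}Y(t)=0$. -/

import Mathlib

open MeasureTheory Set Filter Topology
open scoped ContDiff

noncomputable section

/-- Euclidean space `ℝᴺ`. -/
abbrev Eucl (N : ℕ) : Type := EuclideanSpace ℝ (Fin N)

/-- `φ ∈ C_c^∞(Ω)`. -/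
structure IsTestFunction {N : ℕ} (Ω : Set (Eucl N)) (φ : Eucl N → ℝ) : Prop where
  smooth : ContDiff ℝ ∞ φ
  compact : HasCompactSupport φ
  support : tsupport φ ⊆ Ω

/-- `v ∈ W_0^{1,2}(Ω)`: `v` is the limit of a sequence in `C_c^∞(Ω)` in the norm of `W^{1,2}(Ω)`;
the limit `Dv` of the gradients is the weak gradient of `v`. -/
def MemW012 {N : ℕ} (Ω : Set (Eucl N)) (v : Eucl N → ℝ) : Prop :=
  MemLp v 2 (volume.restrict Ω) ∧
  ∃ Dv : Eucl N → Eucl N, MemLp Dv 2 (volume.restrict Ω) ∧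
    ∃ φ : ℕ → Eucl N → ℝ, (∀ n, IsTestFunction Ω (φ n)) ∧
      Tendsto (fun n => eLpNorm (fun x => φ n x - v x) 2 (volume.restrict Ω)) atTop (𝓝 0) ∧
      Tendsto (fun n => eLpNorm (fun x => gradient (φ n) x - Dv x) 2 (volume.restrict Ω))
        atTop (𝓝 0)

/-- `g = Δ v` in `Ω` in the weak (distributional) sense, with `v, g ∈ L¹_loc(Ω)`. -/
structure IsWeakLaplacian {N : ℕ} (Ω : Set (Eucl N)) (v g : Eucl N → ℝ) : Prop where
  locallyIntegrable_fun : LocallyIntegrableOn v Ω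
  locallyIntegrable_laplacian : LocallyIntegrableOn g Ω
  integral_eq : ∀ φ : Eucl N → ℝ, IsTestFunction Ω φ →
    ∫ x in Ω, v x * Laplacian.laplacian φ x = ∫ x in Ω, g x * φ x

/-- A weight `h ∈ C((0,∞)) ∩ L¹_loc([0,∞))` with `h > 0` on `(0,∞)`. -/
structure IsWeight (h : ℝ → ℝ) : Prop where
  continuousOn : ContinuousOn h (Ioi 0)
  locallyIntegrable : LocallyIntegrableOn h (Ici 0)
  pos : ∀ r, 0 < r → 0 < h r

/-- `H(v) = ∫₀ᵛ h(r) dr`. -/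
def weightPrimitive (h : ℝ → ℝ) (v : ℝ) : ℝ := ∫ r in (0 : ℝ)..v, h r

/-- `H^{γ₁+1} ∈ C¹([0,∞))`, and for every `M > 0` there is `c₁ = c₁(M) > 0` with
`[H^{γ₁+1}]' ≤ c₁` on `[0,M]`. Derivatives at the end point `0` are one-sided. -/
def PowerDerivBoundedAbove (H : ℝ → ℝ) (γ₁ : ℝ) : Prop :=
  ContDiffOn ℝ 1 (fun s => H s ^ (γ₁ + 1)) (Ici 0) ∧
  ∀ M : ℝ, 0 < M → ∃ c₁ : ℝ, 0 < c₁ ∧ ∀ s ∈ Icc (0 : ℝ) M,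
    derivWithin (fun r => H r ^ (γ₁ + 1)) (Ici 0) s ≤ c₁

/-- For every `M > 0` there is `c₂ = c₂(M) > 0` such that `F H^{γ₁+1}` is differentiable with
`[F H^{γ₁+1}]' ≥ c₂` on `[0,M]`. Derivatives at the end point `0` are one-sided. -/
def ProductDerivBoundedBelow (F H : ℝ → ℝ) (γ₁ : ℝ) : Prop :=
  ∀ M : ℝ, 0 < M → ∃ c₂ : ℝ, 0 < c₂ ∧ ∀ s ∈ Icc (0 : ℝ) M,
    DifferentiableWithinAt ℝ (fun r => F r * H r ^ (γ₁ + 1)) (Ici 0) s ∧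
    c₂ ≤ derivWithin (fun r => F r * H r ^ (γ₁ + 1)) (Ici 0) s

/-- `u ≥ 0` is a bounded (strong) solution, with upper bound `M`, of
`[H(u)]_t - F(u) Δu ≤ 0` in `Ω × (t₀,∞)`, `u(·,t₀) = u₀` on `Ω`, `u = 0` on `∂Ω × (t₀,∞)`.
Here `u t x` stands for `u(x,t)`. -/
structure IsBoundedSolution {N : ℕ} (Ω : Set (Eucl N)) (H F : ℝ → ℝ) (t₀ : ℝ)
    (u₀ : Eucl N → ℝ) (M : ℝ) (u : ℝ → Eucl N → ℝ) : Prop where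
  measurable : AEStronglyMeasurable (Function.uncurry u)
    ((volume.restrict (Ioi t₀)).prod (volume.restrict Ω))
  measurable_slice : ∀ t, t₀ ≤ t → AEStronglyMeasurable (u t) (volume.restrict Ω)
  nonneg : ∀ t, t₀ ≤ t → ∀ᵐ x ∂(volume.restrict Ω), 0 ≤ u t x
  le_bound : ∀ t, t₀ < t → ∀ᵐ x ∂(volume.restrict Ω), u t x ≤ M
  initial : ∀ᵐ x ∂(volume.restrict Ω), u t₀ x = u₀ x
  /-- There is `w = [H(u)]_t ∈ L²(Ω × (t₀,∞))` (so `t ↦ H(u(·,t))` is the primitive of `w` on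
  `[t₀,∞)`); for almost every `t` the function `u(·,t)` has zero boundary values in the sense of
  `W_0^{1,2}(Ω)`, it has a weak Laplacian `g` with `F(u) g ∈ L²(Ω)`, and `w ≤ F(u) g`
  almost everywhere. -/
  equation : ∃ w : ℝ → Eucl N → ℝ,
    MemLp (Function.uncurry w) 2 ((volume.restrict (Ioi t₀)).prod (volume.restrict Ω)) ∧
    (∀ t, t₀ ≤ t → ∀ᵐ x ∂(volume.restrict Ω),
      H (u t x) = H (u t₀ x) + ∫ s in t₀..t, w s x) ∧
    ∀ᵐ t ∂(volume.restrict (Ioi t₀)),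
      MemW012 Ω (u t) ∧
      ∃ g : Eucl N → ℝ, IsWeakLaplacian Ω (u t) g ∧
        MemLp (fun x => F (u t x) * g x) 2 (volume.restrict Ω) ∧
        ∀ᵐ x ∂(volume.restrict Ω), w t x - F (u t x) * g x ≤ 0

/-- `Y(t) = ∫_Ω [H(u(x,t))]^{p+1} dx`. -/
def energyY {N : ℕ} (Ω : Set (Eucl N)) (H : ℝ → ℝ) (p : ℝ) (u : ℝ → Eucl N → ℝ) (t : ℝ) : ℝ :=
  ∫ x in Ω, H (u t x) ^ (p + 1)

end

/-! Testing the inequality with `H(u)^p ≥ 0` gives formally `Y'/(p+1) ≤ ∫ G(u) Δu = -∫ G'(u)|∇u|²`,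
where `G = F H^p = (F H^(γ₁+1)) H^(p-γ₁-1)`. Hypothesis (ii) yields `G' ≥ c₂ H^(p-γ₁-1)`, and
hypothesis (i) bounds the squared derivative of `H^((p+1+γ₁)/2)` by a multiple of `H^(p-γ₁-1)`. The
dissipation therefore controls `∫ |∇ H(u)^((p+1+γ₁)/2)|²`. Poincaré's inequality bounds this below
by a multiple of `∫ H(u)^(p+1+γ₁)`, and Jensen's by a multiple of `Y^((p+1+γ₁)/(p+1))`. This
exponent exceeds 1, so `Y^(-γ₁/(p+1))` grows at least linearly, which is the decay rate.

The work lies in the justification, since `Δu` is only locally integrable and `G` need not be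
smooth. `IsSobolevApprox.integral_laplacian_mul_comp` integrates by parts against smooth functions
of `u` vanishing near 0; `integral_sq_primitive_le` reaches `G` by shifted mollification;
`exists_integral_rpow_mul_le` is the resulting inequality at one time. `exists_integral_rpow_eq`
shows that `Y` is the primitive of its formal derivative, and the decay follows from an integrated
form of the differential inequality. -/

/-! ### Limits of integrals of products of `L²` functions. -/

section L2Limits

variable {α E : Type*} [MeasurableSpace α] {μ : Measure α} [NormedAddCommGroup E]

/-- Split `a n * f n = a n * (f n - f') + a n * f'`: the uniform bound on `a n` makes the first term
small in `L¹`, and dominated convergence handles the second. -/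
theorem tendsto_integral_mul_of_tendsto_eLpNorm_one {a : ℕ → α → ℝ} {a' : α → ℝ}
    {f : ℕ → α → ℝ} {f' : α → ℝ} {B : ℝ}
    (ham : ∀ n, AEStronglyMeasurable (a n) μ) (haB : ∀ n, ∀ᵐ x ∂μ, |a n x| ≤ B)
    (ha : ∀ᵐ x ∂μ, Tendsto (fun n => a n x) atTop (𝓝 (a' x)))
    (hf : ∀ n, Integrable (f n) μ) (hf' : Integrable f' μ)
    (h : Tendsto (fun n => eLpNorm (f n - f') 1 μ) atTop (𝓝 0)) :
    Tendsto (fun n => ∫ x, a n x * f n x ∂μ) atTop (𝓝 (∫ x, a' x * f' x ∂μ)) := by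
  have h1 : Tendsto (fun n => ∫ x, a n x * f' x ∂μ) atTop (𝓝 (∫ x, a' x * f' x ∂μ)) := by
    refine tendsto_integral_of_dominated_convergence (fun x => B * |f' x|)
      (fun n => (ham n).mul hf'.aestronglyMeasurable) (hf'.abs.const_mul B) (fun n => ?_) ?_
    · filter_upwards [haB n] with x hx
      rw [norm_mul, Real.norm_eq_abs, Real.norm_eq_abs]
      gcongr
    · filter_upwards [ha] with x hx using hx.mul_const _
  have hai : ∀ n (k : α → ℝ), Integrable k μ → Integrable (fun x => a n x * k x) μ :=
    fun n k hk => hk.bdd_mul (ham n) (haB n)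
  have h2 : Tendsto (fun n => ∫ x, a n x * (f n x - f' x) ∂μ) atTop (𝓝 0) := by
    have hL : Tendsto (fun n => B * (eLpNorm (f n - f') 1 μ).toReal) atTop (𝓝 0) := by
      have := (ENNReal.tendsto_toReal ENNReal.zero_ne_top).comp h
      simpa using this.const_mul B
    refine squeeze_zero_norm (fun n => ?_) hL
    have hi : Integrable (fun x => f n x - f' x) μ := (hf n).sub hf'
    have hn : (eLpNorm (f n - f') 1 μ).toReal = ∫ x, ‖f n x - f' x‖ ∂μ := by
      rw [eLpNorm_one_eq_lintegral_enorm]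
      exact (integral_norm_eq_lintegral_enorm hi.aestronglyMeasurable).symm
    rw [hn, ← integral_const_mul]
    refine norm_integral_le_of_norm_le (hi.norm.const_mul B) ?_
    filter_upwards [haB n] with x hx
    rw [norm_mul, Real.norm_eq_abs]
    gcongr
  have h3 := h2.add h1
  rw [zero_add] at h3
  refine h3.congr fun n => ?_
  rw [← integral_add (hai n (fun x => f n x - f' x) ((hf n).sub hf')) (hai n _ hf')]
  exact integral_congr_ae (ae_of_all _ fun x => by ring)

theorem eLpNorm_le_eLpNorm_sub_add {X X' : α → E} {p : ENNReal} (hp : 1 ≤ p)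
    (hX : AEStronglyMeasurable X μ) (hX' : AEStronglyMeasurable X' μ) :
    eLpNorm X p μ ≤ eLpNorm (X - X') p μ + eLpNorm X' p μ := by
  simpa using eLpNorm_add_le (hX.sub hX') hX' hp

variable [InnerProductSpace ℝ E]

theorem eLpNorm_inner_le {X Y : α → E} (hX : AEStronglyMeasurable X μ)
    (hY : AEStronglyMeasurable Y μ) :
    eLpNorm (fun x => inner ℝ (X x) (Y x)) 1 μ ≤ eLpNorm X 2 μ * eLpNorm Y 2 μ := by
  have := eLpNorm_le_eLpNorm_mul_eLpNorm_of_nnnorm (p := 2) (q := 2) (r := 1) hX hY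
    (fun a b => (inner ℝ a b : ℝ)) 1 (ae_of_all _ fun x => by
      rw [one_mul]; exact nnnorm_inner_le_nnnorm _ _)
  simpa using this

theorem integrable_inner_of_memLp {X Y : α → E} (hX : MemLp X 2 μ) (hY : MemLp Y 2 μ) :
    Integrable (fun x => (inner ℝ (X x) (Y x) : ℝ)) μ := by
  rw [← memLp_one_iff_integrable]
  exact ⟨hX.1.inner hY.1, (eLpNorm_inner_le hX.1 hY.1).trans_lt (ENNReal.mul_lt_top hX.2 hY.2)⟩

theorem tendsto_eLpNorm_inner_sub {X Y : ℕ → α → E} {X' Y' : α → E}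
    (hX : ∀ n, MemLp (X n) 2 μ) (hY : ∀ n, MemLp (Y n) 2 μ)
    (hX' : MemLp X' 2 μ) (hY' : MemLp Y' 2 μ)
    (hXX : Tendsto (fun n => eLpNorm (X n - X') 2 μ) atTop (𝓝 0))
    (hYY : Tendsto (fun n => eLpNorm (Y n - Y') 2 μ) atTop (𝓝 0)) :
    Tendsto (fun n => eLpNorm ((fun x => (inner ℝ (X n x) (Y n x) : ℝ)) -
      fun x => (inner ℝ (X' x) (Y' x) : ℝ)) 1 μ) atTop (𝓝 0) := by
  have hlim : Tendsto (fun n => (eLpNorm (X n - X') 2 μ + eLpNorm X' 2 μ) *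
      eLpNorm (Y n - Y') 2 μ + eLpNorm (X n - X') 2 μ * eLpNorm Y' 2 μ) atTop (𝓝 0) := by
    have h1 := ENNReal.Tendsto.mul (hXX.add_const (eLpNorm X' 2 μ)) (Or.inr ENNReal.zero_ne_top)
      hYY (Or.inr (by rw [zero_add]; exact hX'.2.ne))
    have h2 := ENNReal.Tendsto.mul_const (b := eLpNorm Y' 2 μ) hXX (Or.inr hY'.2.ne)
    simpa using h1.add h2
  refine tendsto_of_tendsto_of_tendsto_of_le_of_le tendsto_const_nhds hlim (fun _ => zero_le)
    fun n => ?_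
  have he : ((fun x => (inner ℝ (X n x) (Y n x) : ℝ)) - fun x => (inner ℝ (X' x) (Y' x) : ℝ)) =
      (fun x => inner ℝ (X n x) ((Y n - Y') x)) + fun x => inner ℝ ((X n - X') x) (Y' x) := by
    funext x
    simp only [Pi.sub_apply, Pi.add_apply, inner_sub_left, inner_sub_right]
    ring
  rw [he]
  refine (eLpNorm_add_le ((hX n).1.inner ((hY n).1.sub hY'.1))
    (((hX n).1.sub hX'.1).inner hY'.1) le_rfl).trans (add_le_add ?_ ?_)
  · refine (eLpNorm_inner_le (hX n).1 ((hY n).1.sub hY'.1)).trans ?_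
    gcongr
    exact eLpNorm_le_eLpNorm_sub_add (by norm_num) (hX n).1 hX'.1
  · exact eLpNorm_inner_le ((hX n).1.sub hX'.1) hY'.1

/-- The tool for passing from test functions to Sobolev functions: gradients converge in `L²`, while
nonlinear coefficients are only bounded and converge almost everywhere. -/
theorem tendsto_integral_mul_inner {a : ℕ → α → ℝ} {a' : α → ℝ} {X Y : ℕ → α → E}
    {X' Y' : α → E} {B : ℝ}
    (ham : ∀ n, AEStronglyMeasurable (a n) μ) (haB : ∀ n, ∀ᵐ x ∂μ, |a n x| ≤ B)
    (ha : ∀ᵐ x ∂μ, Tendsto (fun n => a n x) atTop (𝓝 (a' x)))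
    (hX : ∀ n, MemLp (X n) 2 μ) (hY : ∀ n, MemLp (Y n) 2 μ)
    (hX' : MemLp X' 2 μ) (hY' : MemLp Y' 2 μ)
    (hXX : Tendsto (fun n => eLpNorm (X n - X') 2 μ) atTop (𝓝 0))
    (hYY : Tendsto (fun n => eLpNorm (Y n - Y') 2 μ) atTop (𝓝 0)) :
    Tendsto (fun n => ∫ x, a n x * inner ℝ (X n x) (Y n x) ∂μ) atTop
      (𝓝 (∫ x, a' x * inner ℝ (X' x) (Y' x) ∂μ)) :=
  tendsto_integral_mul_of_tendsto_eLpNorm_one ham haB ha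
    (fun n => integrable_inner_of_memLp (hX n) (hY n)) (integrable_inner_of_memLp hX' hY')
    (tendsto_eLpNorm_inner_sub hX hY hX' hY' hXX hYY)

end L2Limits

/-! ### Calculus of test functions: Poincaré and Green. -/

section TestFunctions

variable {N : ℕ}

theorem gradient_eq_zero_of_notMem_tsupport {φ : Eucl N → ℝ} {x : Eucl N} (hx : x ∉ tsupport φ) :
    gradient φ x = 0 := by
  rw [gradient, fderiv_of_notMem_tsupport ℝ hx, map_zero]

theorem continuous_gradient {φ : Eucl N → ℝ} (hφ : ContDiff ℝ 1 φ) : Continuous (gradient φ) :=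
  (InnerProductSpace.toDual ℝ (Eucl N)).symm.continuous.comp (hφ.continuous_fderiv one_ne_zero)

theorem hasCompactSupport_gradient {φ : Eucl N → ℝ} (hφ : HasCompactSupport φ) :
    HasCompactSupport (gradient φ) :=
  HasCompactSupport.intro hφ fun _ hx => gradient_eq_zero_of_notMem_tsupport hx

theorem gradient_comp {K : ℝ → ℝ} {φ : Eucl N → ℝ} {x : Eucl N}
    (hK : DifferentiableAt ℝ K (φ x)) (hφ : DifferentiableAt ℝ φ x) :
    gradient (fun y => K (φ y)) x = deriv K (φ x) • gradient φ x := by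
  have h := hK.hasDerivAt.comp_hasFDerivAt x hφ.hasFDerivAt
  have h' : fderiv ℝ (fun y => K (φ y)) x = deriv K (φ x) • fderiv ℝ φ x := h.fderiv
  rw [gradient, gradient, h', map_smul]

theorem gradient_mul {φ ψ : Eucl N → ℝ} {x : Eucl N}
    (hφ : DifferentiableAt ℝ φ x) (hψ : DifferentiableAt ℝ ψ x) :
    gradient (fun y => φ y * ψ y) x = φ x • gradient ψ x + ψ x • gradient φ x := by
  have h' : fderiv ℝ (fun y => φ y * ψ y) x = φ x • fderiv ℝ ψ x + ψ x • fderiv ℝ φ x :=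
    (hφ.hasFDerivAt.mul hψ.hasFDerivAt).fderiv
  simp only [gradient, h', map_add, map_smul]

variable {Ω : Set (Eucl N)} {φ ψ : Eucl N → ℝ}

theorem IsTestFunction.contDiff_one (hφ : IsTestFunction Ω φ) : ContDiff ℝ 1 φ :=
  hφ.smooth.of_le (by exact_mod_cast le_top)

theorem IsTestFunction.memLp (hφ : IsTestFunction Ω φ) (p : ENNReal) :
    MemLp φ p (volume.restrict Ω) :=
  (hφ.smooth.continuous.memLp_of_hasCompactSupport hφ.compact).restrict Ω

theorem IsTestFunction.memLp_gradient (hφ : IsTestFunction Ω φ) (p : ENNReal) :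
    MemLp (gradient φ) p (volume.restrict Ω) :=
  ((continuous_gradient hφ.contDiff_one).memLp_of_hasCompactSupport
    (hasCompactSupport_gradient hφ.compact)).restrict Ω

/-- The second factor alone confines the support, so `L` need not vanish at 0. -/
theorem IsTestFunction.comp_mul_comp (hφ : ContDiff ℝ ∞ φ) (hψ : IsTestFunction Ω ψ)
    {L χ : ℝ → ℝ} (hL : ContDiff ℝ ∞ L) (hχ : ContDiff ℝ ∞ χ) (hχ0 : χ 0 = 0) :
    IsTestFunction Ω (fun x => L (φ x) * χ (ψ x)) := by
  have hsub : tsupport (fun x => L (φ x) * χ (ψ x)) ⊆ tsupport ψ :=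
    (tsupport_mul_subset_right (f := fun x => L (φ x)) (g := fun x => χ (ψ x))).trans
      (tsupport_comp_subset hχ0 ψ)
  exact ⟨(hL.comp hφ).mul (hχ.comp hψ.smooth), hψ.compact.of_isClosed_subset
    (isClosed_tsupport _) hsub, hsub.trans hψ.support⟩

/-- Poincaré's inequality for compactly supported `C¹` functions on a bounded set. -/
theorem integral_sq_le_integral_norm_gradient_sq (hN : 0 < N) {R : ℝ}
    (hφ : ContDiff ℝ 1 φ) (hc : HasCompactSupport φ) (hR : tsupport φ ⊆ Metric.closedBall 0 R) :
    ∫ x, φ x ^ 2 ≤ (2 * R) ^ 2 * ∫ x, ‖gradient φ x‖ ^ 2 := by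
  let e : Eucl N := EuclideanSpace.single ⟨0, hN⟩ 1
  have he : ‖e‖ = 1 := by simp [e]
  let l : Eucl N →L[ℝ] ℝ := innerSL ℝ e
  have hle : l e = 1 := by simp [l, he]
  have hd : ∀ x, fderiv ℝ (fun y => φ y ^ 2) x e = 2 * φ x * fderiv ℝ φ x e := by
    intro x
    have h := ((hφ.differentiable one_ne_zero x).hasFDerivAt.pow 2).fderiv
    have h' : fderiv ℝ (fun y => φ y ^ 2) x = (2 * φ x) • fderiv ℝ φ x := by
      simpa using h
    rw [h']; simp
  have hcφ := hφ.continuous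
  have hcd : Continuous fun x => fderiv ℝ φ x e :=
    (hφ.continuous_fderiv one_ne_zero).clm_apply continuous_const
  have hcz : ∀ {k : Eucl N → ℝ}, Continuous k → (∀ x, x ∉ tsupport φ → k x = 0) →
      Integrable k := fun hk h0 =>
    hk.integrable_of_hasCompactSupport (HasCompactSupport.intro hc h0)
  have h0 : ∀ x, x ∉ tsupport φ → φ x = 0 := fun x hx => image_eq_zero_of_notMem_tsupport hx
  have hsq : Integrable fun x => φ x ^ 2 := hcz (hcφ.pow 2) fun x hx => by simp [h0 x hx]
  have hgr : Integrable fun x => ‖gradient φ x‖ ^ 2 :=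
    hcz ((continuous_gradient hφ).norm.pow 2) fun x hx => by
      simp [gradient_eq_zero_of_notMem_tsupport hx]
  -- The coordinate `l` has derivative 1 along `e`, so integration by parts turns `∫ φ²` into `-∫ 2
  -- l φ ∂ₑφ`.
  have hparts : ∫ x, l x * fderiv ℝ (fun y => φ y ^ 2) x e =
      - ∫ x, fderiv ℝ l x e * φ x ^ 2 := by
    refine integral_mul_fderiv_eq_neg_fderiv_mul_of_integrable ?_ ?_ ?_
      (fun x _ => l.differentiableAt)
      (fun x _ => (hφ.differentiable one_ne_zero x).pow 2)
    · simpa [hle] using hsq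
    · simp only [hd]
      exact hcz (l.continuous.mul ((continuous_const.mul hcφ).mul hcd)) fun x hx => by
        simp [h0 x hx]
    · exact hcz (l.continuous.mul (hcφ.pow 2)) fun x hx => by simp [h0 x hx]
  simp only [hd, ContinuousLinearMap.fderiv, hle, one_mul] at hparts
  -- Young's inequality with `|l| ≤ R` on the support; absorbing `φ² / 2` into the left side then
  -- produces the constant `(2R)²`.
  have hpt : ∀ x, -(l x * (2 * φ x * fderiv ℝ φ x e)) ≤
      φ x ^ 2 / 2 + 2 * R ^ 2 * ‖gradient φ x‖ ^ 2 := by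
    intro x
    by_cases hx : x ∈ tsupport φ
    · have h1 : |l x| ≤ R := by
        have := abs_real_inner_le_norm e x
        rw [he, one_mul] at this
        exact this.trans (by simpa using hR hx)
      have h2 : |fderiv ℝ φ x e| ≤ ‖gradient φ x‖ := by
        rw [← inner_gradient_left]
        simpa [he] using abs_real_inner_le_norm (gradient φ x) e
      have h3 : |l x * fderiv ℝ φ x e| ≤ R * ‖gradient φ x‖ := by
        rw [abs_mul]
        exact mul_le_mul h1 h2 (abs_nonneg _) ((abs_nonneg _).trans h1)
      have h4 : (l x * fderiv ℝ φ x e) ^ 2 ≤ (R * ‖gradient φ x‖) ^ 2 := by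
        rw [← sq_abs]; gcongr
      nlinarith [sq_nonneg (φ x + 2 * (l x * fderiv ℝ φ x e))]
    · rw [h0 x hx]
      simp only [mul_zero, zero_mul, neg_zero]
      positivity
  have hfin : ∫ x, φ x ^ 2 ≤ ∫ x, (φ x ^ 2 / 2 + 2 * R ^ 2 * ‖gradient φ x‖ ^ 2) := by
    have : ∫ x, φ x ^ 2 = ∫ x, -(l x * (2 * φ x * fderiv ℝ φ x e)) := by
      rw [integral_neg, hparts, neg_neg]
    rw [this]
    refine integral_mono ?_ ((hsq.div_const 2).add (hgr.const_mul _)) hpt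
    exact (hcz (l.continuous.mul ((continuous_const.mul hcφ).mul hcd)) fun x hx => by
        simp [h0 x hx]).neg
  rw [integral_add (hsq.div_const 2) (hgr.const_mul _), integral_div, integral_const_mul] at hfin
  nlinarith

/-- Green's formula for two test functions. -/
theorem integral_mul_laplacian_eq_neg_integral_inner_gradient (hφ : ContDiff ℝ ∞ φ)
    (hψ : ContDiff ℝ ∞ ψ) (hc : HasCompactSupport ψ) :
    ∫ x, φ x * Laplacian.laplacian ψ x = - ∫ x, inner ℝ (gradient φ x) (gradient ψ x) := by
  let b := EuclideanSpace.basisFun (Fin N) ℝ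
  have hφ1 : ContDiff ℝ 1 φ := hφ.of_le (by exact_mod_cast le_top)
  have hψ' : ContDiff ℝ 1 (fderiv ℝ ψ) :=
    (contDiff_infty_iff_fderiv.1 hψ).2.of_le (by exact_mod_cast le_top)
  have hψi : ∀ i, ContDiff ℝ 1 fun x => fderiv ℝ ψ x (b i) := fun i =>
    hψ'.clm_apply contDiff_const
  have hlap : ∀ x, Laplacian.laplacian ψ x =
      ∑ i, fderiv ℝ (fun y => fderiv ℝ ψ y (b i)) x (b i) := by
    intro x
    rw [InnerProductSpace.laplacian_eq_iteratedFDeriv_orthonormalBasis ψ b]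
    refine Finset.sum_congr rfl fun i _ => ?_
    rw [iteratedFDeriv_two_apply]
    simp only [Matrix.cons_val_zero, Matrix.cons_val_one]
    have h := (hψ'.differentiable one_ne_zero x).hasFDerivAt.clm_apply
      (hasFDerivAt_const (b i) x)
    rw [h.fderiv]
    simp
  have hgrad : ∀ x, (inner ℝ (gradient φ x) (gradient ψ x) : ℝ) =
      ∑ i, fderiv ℝ φ x (b i) * fderiv ℝ ψ x (b i) := by
    intro x
    rw [← b.sum_inner_mul_inner]
    refine Finset.sum_congr rfl fun i _ => ?_
    rw [inner_gradient_left, real_inner_comm, inner_gradient_left]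
  have hcz : ∀ {k : Eucl N → ℝ}, Continuous k → (∀ x, x ∉ tsupport ψ → k x = 0) →
      Integrable k := fun hk h0 =>
    hk.integrable_of_hasCompactSupport (HasCompactSupport.intro hc h0)
  have hc1 : ∀ i, Continuous fun x => fderiv ℝ φ x (b i) := fun i =>
    (hφ1.continuous_fderiv one_ne_zero).clm_apply continuous_const
  have hc2 : ∀ i, Continuous fun x => fderiv ℝ (fun y => fderiv ℝ ψ y (b i)) x (b i) := fun i =>
    ((hψi i).continuous_fderiv one_ne_zero).clm_apply continuous_const
  have hz1 : ∀ i x, x ∉ tsupport ψ → fderiv ℝ ψ x (b i) = 0 := fun i x hx => by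
    rw [fderiv_of_notMem_tsupport ℝ hx]; rfl
  have hz2 : ∀ i x, x ∉ tsupport ψ → fderiv ℝ (fun y => fderiv ℝ ψ y (b i)) x (b i) = 0 :=
    fun i x hx => by
      rw [fderiv_of_notMem_tsupport]
      · rfl
      · exact fun h => hx ((tsupport_fderiv_apply_subset ℝ (b i)) h)
  have hI1 : ∀ i, Integrable fun x => φ x * fderiv ℝ (fun y => fderiv ℝ ψ y (b i)) x (b i) :=
    fun i => hcz (hφ.continuous.mul (hc2 i)) fun x hx => by rw [hz2 i x hx, mul_zero]
  have hI2 : ∀ i, Integrable fun x => fderiv ℝ φ x (b i) * fderiv ℝ ψ x (b i) :=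
    fun i => hcz ((hc1 i).mul (hψi i).continuous) fun x hx => by rw [hz1 i x hx, mul_zero]
  simp only [hlap, hgrad, Finset.mul_sum]
  rw [integral_finsetSum _ fun i _ => hI1 i, integral_finsetSum _ fun i _ => hI2 i,
    ← Finset.sum_neg_distrib]
  refine Finset.sum_congr rfl fun i _ => ?_
  refine integral_mul_fderiv_eq_neg_fderiv_mul_of_integrable (hI2 i) (hI1 i) ?_
    (fun x _ => hφ1.differentiable one_ne_zero x) (fun x _ => (hψi i).differentiable one_ne_zero x)
  exact hcz (hφ.continuous.mul (hψi i).continuous) fun x hx => by rw [hz1 i x hx, mul_zero]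

end TestFunctions

/-! ### Poincaré's inequality and integration by parts in `W_0^{1,2}(Ω)`. -/

section Sobolev

variable {N : ℕ} {Ω : Set (Eucl N)}

/-- Test functions `φ n` which converge in `W^{1,2}(Ω)` and almost everywhere to `v`, with weak
gradient `Dv`. -/
structure IsSobolevApprox (Ω : Set (Eucl N)) (v : Eucl N → ℝ) (Dv : Eucl N → Eucl N)
    (φ : ℕ → Eucl N → ℝ) : Prop where
  memLp : MemLp v 2 (volume.restrict Ω)
  memLp_grad : MemLp Dv 2 (volume.restrict Ω)
  test : ∀ n, IsTestFunction Ω (φ n)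
  tendsto : Tendsto (fun n => eLpNorm (φ n - v) 2 (volume.restrict Ω)) atTop (𝓝 0)
  tendsto_grad :
    Tendsto (fun n => eLpNorm (gradient (φ n) - Dv) 2 (volume.restrict Ω)) atTop (𝓝 0)
  tendsto_ae : ∀ᵐ x ∂(volume.restrict Ω), Tendsto (fun n => φ n x) atTop (𝓝 (v x))

theorem MemW012.exists_approx {v : Eucl N → ℝ} (hv : MemW012 Ω v) :
    ∃ Dv φ, IsSobolevApprox Ω v Dv φ := by
  obtain ⟨hv2, Dv, hDv, φ, hφ, h1, h2⟩ := hv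
  obtain ⟨ns, hns, hae⟩ := (tendstoInMeasure_of_tendsto_eLpNorm (p := 2) two_ne_zero
    (fun n => ((hφ n).memLp 2).1) hv2.1 h1).exists_seq_tendsto_ae
  exact ⟨Dv, fun n => φ (ns n), hv2, hDv, fun n => hφ _, h1.comp hns.tendsto_atTop,
    h2.comp hns.tendsto_atTop, hae⟩

variable {v g : Eucl N → ℝ} {Dv : Eucl N → Eucl N} {φ : ℕ → Eucl N → ℝ}

theorem tendsto_eLpNorm_const_sub {α E : Type*} [MeasurableSpace α] {μ : Measure α}
    [NormedAddCommGroup E] (X : α → E) (p : ENNReal) :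
    Tendsto (fun _ : ℕ => eLpNorm (X - X) p μ) atTop (𝓝 0) := by
  simp

theorem abs_sub_le_of_abs_deriv_le {K : ℝ → ℝ} {B : ℝ} (hK : Differentiable ℝ K)
    (hB : ∀ s, |deriv K s| ≤ B) (s t : ℝ) : |K s - K t| ≤ B * |s - t| := by
  have := Convex.norm_image_sub_le_of_norm_deriv_le (f := K) (s := univ) (x := t) (y := s) (C := B)
    (fun x _ => hK x) (fun x _ => hB x) convex_univ (mem_univ _) (mem_univ _)
  simpa using this

/-- Poincaré's inequality holds for each `K (φ n)`, a compactly supported `C¹` function because `K 0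
= 0`. The bound on `deriv K` makes both sides converge, so no chain rule for weak gradients is
needed. -/
theorem IsSobolevApprox.integral_sq_comp_le (hN : 0 < N) {R : ℝ}
    (hR : Ω ⊆ Metric.closedBall 0 R) (hv : IsSobolevApprox Ω v Dv φ) {K : ℝ → ℝ} {B : ℝ}
    (hK : ContDiff ℝ 1 K) (hK0 : K 0 = 0) (hB : ∀ s, |deriv K s| ≤ B) :
    ∫ x in Ω, K (v x) ^ 2 ≤ (2 * R) ^ 2 * ∫ x in Ω, deriv K (v x) ^ 2 * ‖Dv x‖ ^ 2 := by
  have hB0 : 0 ≤ B := (abs_nonneg _).trans (hB 0)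
  have hlip := abs_sub_le_of_abs_deriv_le (hK.differentiable one_ne_zero) hB
  have hsub : ∀ n, tsupport (fun x => K (φ n x)) ⊆ tsupport (φ n) := fun n =>
    tsupport_comp_subset hK0 (φ n)
  have hcK : ∀ n, HasCompactSupport fun x => K (φ n x) := fun n =>
    (hv.test n).compact.of_isClosed_subset (isClosed_tsupport _) (hsub n)
  have hCK : ∀ n, ContDiff ℝ 1 fun x => K (φ n x) := fun n => hK.comp (hv.test n).contDiff_one
  have hmem : ∀ n, MemLp (fun x => K (φ n x)) 2 (volume.restrict Ω) := fun n =>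
    ((hCK n).continuous.memLp_of_hasCompactSupport (hcK n)).restrict Ω
  have hmem' : MemLp (fun x => K (v x)) 2 (volume.restrict Ω) := by
    refine (hv.memLp.norm.const_mul B).of_le (hK.continuous.comp_aestronglyMeasurable hv.memLp.1)
      (ae_of_all _ fun x => ?_)
    have := hlip (v x) 0
    rw [hK0, sub_zero, sub_zero] at this
    simpa [abs_of_nonneg hB0] using this
  have hn : ∀ n, ∫ x in Ω, (1 : ℝ) * inner ℝ (K (φ n x)) (K (φ n x)) ≤
      (2 * R) ^ 2 * ∫ x in Ω, deriv K (φ n x) ^ 2 * inner ℝ (gradient (φ n) x)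
        (gradient (φ n) x) := by
    intro n
    have h := integral_sq_le_integral_norm_gradient_sq hN (hCK n) (hcK n)
      ((hsub n).trans ((hv.test n).support.trans hR))
    rw [setIntegral_eq_integral_of_forall_compl_eq_zero,
      setIntegral_eq_integral_of_forall_compl_eq_zero]
    · refine (le_of_eq ?_).trans (h.trans (le_of_eq ?_))
      · exact integral_congr_ae (ae_of_all _ fun x => by simp [sq])
      · congr 1
        refine integral_congr_ae (ae_of_all _ fun x => ?_)
        simp only
        rw [gradient_comp (hK.differentiable one_ne_zero _)
          ((hv.test n).contDiff_one.differentiable one_ne_zero x), norm_smul,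
          real_inner_self_eq_norm_sq, mul_pow, Real.norm_eq_abs, sq_abs]
    · intro x hx
      rw [gradient_eq_zero_of_notMem_tsupport fun h => hx ((hv.test n).support h)]
      simp
    · intro x hx
      rw [image_eq_zero_of_notMem_tsupport fun h => hx ((hv.test n).support h), hK0]
      simp
  have hl : Tendsto (fun n => ∫ x in Ω, (1 : ℝ) * inner ℝ (K (φ n x)) (K (φ n x))) atTop
      (𝓝 (∫ x in Ω, (1 : ℝ) * inner ℝ (K (v x)) (K (v x)))) := by
    have ht : Tendsto (fun n => eLpNorm ((fun x => K (φ n x)) - fun x => K (v x)) 2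
        (volume.restrict Ω)) atTop (𝓝 0) := by
      have h0 : Tendsto (fun n => ENNReal.ofReal B * eLpNorm (φ n - v) 2 (volume.restrict Ω))
          atTop (𝓝 0) := by
        simpa using ENNReal.Tendsto.const_mul hv.tendsto (Or.inr ENNReal.ofReal_ne_top)
      refine tendsto_of_tendsto_of_tendsto_of_le_of_le tendsto_const_nhds h0 (fun _ => zero_le)
        fun n => ?_
      exact eLpNorm_le_mul_eLpNorm_of_ae_le_mul (ae_of_all _ fun x => hlip _ _) 2
    exact tendsto_integral_mul_inner (B := 1) (fun n => aestronglyMeasurable_const)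
      (fun n => ae_of_all _ fun x => by simp) (ae_of_all _ fun x => tendsto_const_nhds)
      hmem hmem hmem' hmem' ht ht
  have hc' : Continuous (deriv K) := hK.continuous_deriv le_rfl
  have hr : Tendsto (fun n => ∫ x in Ω, deriv K (φ n x) ^ 2 *
      inner ℝ (gradient (φ n) x) (gradient (φ n) x)) atTop
      (𝓝 (∫ x in Ω, deriv K (v x) ^ 2 * inner ℝ (Dv x) (Dv x))) :=
    tendsto_integral_mul_inner (B := B ^ 2)
      (fun n => ((hc'.comp (hv.test n).smooth.continuous).pow 2).aestronglyMeasurable)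
      (fun n => ae_of_all _ fun x => by
        rw [abs_pow]
        exact pow_le_pow_left₀ (abs_nonneg _) (hB _) 2)
      (by filter_upwards [hv.tendsto_ae] with x hx using ((hc'.tendsto _).comp hx).pow 2)
      (fun n => (hv.test n).memLp_gradient 2) (fun n => (hv.test n).memLp_gradient 2)
      hv.memLp_grad hv.memLp_grad hv.tendsto_grad hv.tendsto_grad
  have := le_of_tendsto_of_tendsto' hl (hr.const_mul _) hn
  simpa [real_inner_self_eq_norm_sq, ← sq] using this

theorem IsSobolevApprox.integral_laplacian_mul (hv : IsSobolevApprox Ω v Dv φ)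
    (hg : IsWeakLaplacian Ω v g) {ψ : Eucl N → ℝ} (hψ : IsTestFunction Ω ψ) :
    ∫ x in Ω, g x * ψ x = - ∫ x in Ω, inner ℝ (Dv x) (gradient ψ x) := by
  rw [← hg.integral_eq ψ hψ]
  have hcl : Continuous (Laplacian.laplacian ψ) := by
    have h2 : Continuous (iteratedFDeriv ℝ 2 ψ) :=
      hψ.smooth.continuous_iteratedFDeriv (WithTop.coe_le_coe.2 (le_top : (2 : ℕ∞) ≤ ⊤))
    rw [InnerProductSpace.laplacian_eq_iteratedFDeriv_orthonormalBasis ψ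
      (EuclideanSpace.basisFun (Fin N) ℝ)]
    exact continuous_finsetSum _ fun i _ => (continuous_eval_const _).comp h2
  have hzl : ∀ x, x ∉ tsupport ψ → Laplacian.laplacian ψ x = 0 := by
    intro x hx
    rw [InnerProductSpace.laplacian_eq_iteratedFDeriv_orthonormalBasis ψ
      (EuclideanSpace.basisFun (Fin N) ℝ)]
    refine Finset.sum_eq_zero fun i _ => ?_
    have : iteratedFDeriv ℝ 2 ψ x = 0 := by
      by_contra h
      exact hx (support_iteratedFDeriv_subset (𝕜 := ℝ) 2 h)
    rw [this]; rfl
  have hml : MemLp (Laplacian.laplacian ψ) 2 (volume.restrict Ω) :=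
    (hcl.memLp_of_hasCompactSupport (HasCompactSupport.intro hψ.compact hzl)).restrict Ω
  have hn : ∀ n, ∫ x in Ω, (1 : ℝ) * inner ℝ (φ n x) (Laplacian.laplacian ψ x) =
      - ∫ x in Ω, (1 : ℝ) * inner ℝ (gradient (φ n) x) (gradient ψ x) := by
    intro n
    rw [setIntegral_eq_integral_of_forall_compl_eq_zero,
      setIntegral_eq_integral_of_forall_compl_eq_zero]
    · have := integral_mul_laplacian_eq_neg_integral_inner_gradient (hv.test n).smooth
        hψ.smooth hψ.compact
      simpa [mul_comm] using this
    · intro x hx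
      rw [gradient_eq_zero_of_notMem_tsupport fun h => hx (hψ.support h)]
      simp
    · intro x hx
      rw [hzl x fun h => hx (hψ.support h)]
      simp
  have h1 : ∀ᵐ x ∂(volume.restrict Ω), Tendsto (fun _ : ℕ => (1 : ℝ)) atTop (𝓝 1) :=
    ae_of_all _ fun x => tendsto_const_nhds
  have hl := tendsto_integral_mul_inner (B := 1) (fun n => aestronglyMeasurable_const)
      (fun n => ae_of_all _ fun x => by simp) h1
      (fun n => (hv.test n).memLp 2) (fun _ => hml) hv.memLp hml hv.tendsto
      (tendsto_eLpNorm_const_sub _ _)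
  have hr := tendsto_integral_mul_inner (B := 1) (fun n => aestronglyMeasurable_const)
      (fun n => ae_of_all _ fun x => by simp) h1
      (fun n => (hv.test n).memLp_gradient 2) (fun _ => hψ.memLp_gradient 2) hv.memLp_grad
      (hψ.memLp_gradient 2) hv.tendsto_grad (tendsto_eLpNorm_const_sub _ _)
  have := tendsto_nhds_unique hl (hr.neg.congr fun n => (hn n).symm)
  simpa [mul_comm] using this

/-- The factor `χ (ψ x)` keeps all supports inside the fixed compact set `tsupport ψ`, where `g` is
integrable; this allows `φ n → v` inside `L` although `g` is only locally integrable on `Ω`. -/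
theorem IsSobolevApprox.integral_laplacian_mul_comp_mul_comp (hv : IsSobolevApprox Ω v Dv φ)
    (hg : IsWeakLaplacian Ω v g) {ψ : Eucl N → ℝ} (hψ : IsTestFunction Ω ψ)
    {L χ : ℝ → ℝ} {B : ℝ} (hL : ContDiff ℝ ∞ L) (hχ : ContDiff ℝ ∞ χ) (hχ0 : χ 0 = 0)
    (hLB : ∀ s, |L s| ≤ B) (hLB' : ∀ s, |deriv L s| ≤ B)
    (hχB : ∀ s, |χ s| ≤ B) (hχB' : ∀ s, |deriv χ s| ≤ B) :
    ∫ x in Ω, g x * (L (v x) * χ (ψ x)) =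
      -(∫ x in Ω, deriv L (v x) * χ (ψ x) * inner ℝ (Dv x) (Dv x)) -
        ∫ x in Ω, L (v x) * deriv χ (ψ x) * inner ℝ (Dv x) (gradient ψ x) := by
  have hB0 : 0 ≤ B := (abs_nonneg _).trans (hLB 0)
  have hLd : Continuous (deriv L) := hL.continuous_deriv (by exact_mod_cast le_top)
  have hχd : Continuous (deriv χ) := hχ.continuous_deriv (by exact_mod_cast le_top)
  have hLD : Differentiable ℝ L := hL.differentiable (by simp)
  have hχD : Differentiable ℝ χ := hχ.differentiable (by simp)
  have hcφ : ∀ n, Continuous (φ n) := fun n => (hv.test n).smooth.continuous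
  have hcψ : Continuous ψ := hψ.smooth.continuous
  have hbb : ∀ {a b : ℝ}, |a| ≤ B → |b| ≤ B → |a * b| ≤ B * B := fun {a b} ha hb => by
    rw [abs_mul]; exact mul_le_mul ha hb (abs_nonneg _) hB0
  have hm1 : ∀ n, AEStronglyMeasurable (fun x => deriv L (φ n x) * χ (ψ x))
      (volume.restrict Ω) := fun n =>
    ((hLd.comp (hcφ n)).mul (hχ.continuous.comp hcψ)).aestronglyMeasurable
  have hm2 : ∀ n, AEStronglyMeasurable (fun x => L (φ n x) * deriv χ (ψ x))
      (volume.restrict Ω) := fun n =>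
    ((hL.continuous.comp (hcφ n)).mul (hχd.comp hcψ)).aestronglyMeasurable
  have hn : ∀ n, ∫ x in Ω, g x * (L (φ n x) * χ (ψ x)) =
      -(∫ x in Ω, deriv L (φ n x) * χ (ψ x) * inner ℝ (Dv x) (gradient (φ n) x)) -
        ∫ x in Ω, L (φ n x) * deriv χ (ψ x) * inner ℝ (Dv x) (gradient ψ x) := by
    intro n
    rw [hv.integral_laplacian_mul hg (IsTestFunction.comp_mul_comp (hv.test n).smooth hψ hL hχ hχ0),
      ← neg_add', ← integral_add]
    · congr 1
      refine integral_congr_ae (ae_of_all _ fun x => ?_)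
      simp only
      have dφ := (hv.test n).contDiff_one.differentiable one_ne_zero x
      have dψ := hψ.contDiff_one.differentiable one_ne_zero x
      rw [gradient_mul (φ := fun x => L (φ n x)) (ψ := fun x => χ (ψ x))
        ((hLD _).comp x dφ) ((hχD _).comp x dψ), gradient_comp (hLD _) dφ,
        gradient_comp (hχD _) dψ]
      simp only [inner_add_right, inner_smul_right]
      ring
    · exact (integrable_inner_of_memLp hv.memLp_grad ((hv.test n).memLp_gradient 2)).bdd_mul
        (hm1 n) (ae_of_all _ fun x => hbb (hLB' _) (hχB _))
    · exact (integrable_inner_of_memLp hv.memLp_grad (hψ.memLp_gradient 2)).bdd_mul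
        (hm2 n) (ae_of_all _ fun x => hbb (hLB _) (hχB' _))
  have hl : Tendsto (fun n => ∫ x in Ω, g x * (L (φ n x) * χ (ψ x))) atTop
      (𝓝 (∫ x in Ω, g x * (L (v x) * χ (ψ x)))) := by
    have hgm := hg.locallyIntegrable_laplacian.aestronglyMeasurable
    have hgi : IntegrableOn g (tsupport ψ) :=
      hg.locallyIntegrable_laplacian.integrableOn_compact_subset hψ.support hψ.compact
    refine tendsto_integral_of_dominated_convergence
      ((tsupport ψ).indicator fun x => |g x| * (B * B))
      (fun n => hgm.mul ((hL.continuous.comp (hcφ n)).mul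
        (hχ.continuous.comp hcψ)).aestronglyMeasurable) ?_ (fun n => ae_of_all _ fun x => ?_) ?_
    · exact (integrable_indicator_iff (isClosed_tsupport _).measurableSet).2
        ((hgi.abs.mul_const _).mono_measure (Measure.restrict_mono le_rfl
          Measure.restrict_le_self))
    · by_cases hx : x ∈ tsupport ψ
      · rw [indicator_of_mem hx, norm_mul, Real.norm_eq_abs, Real.norm_eq_abs]
        exact mul_le_mul_of_nonneg_left (hbb (hLB _) (hχB _)) (abs_nonneg _)
      · rw [indicator_of_notMem hx, image_eq_zero_of_notMem_tsupport hx, hχ0]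
        simp
    · filter_upwards [hv.tendsto_ae] with x hx
      exact ((((hL.continuous.tendsto _).comp hx).mul_const _).const_mul _)
  have hr1 := tendsto_integral_mul_inner (X := fun _ => Dv) (B := B * B) hm1
    (fun n => ae_of_all _ fun x => hbb (hLB' _) (hχB _))
    (a' := fun x => deriv L (v x) * χ (ψ x))
    (by filter_upwards [hv.tendsto_ae] with x hx using ((hLd.tendsto _).comp hx).mul_const _)
    (fun _ => hv.memLp_grad) (fun n => (hv.test n).memLp_gradient 2)
    hv.memLp_grad hv.memLp_grad (tendsto_eLpNorm_const_sub _ _) hv.tendsto_grad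
  have hr2 := tendsto_integral_mul_inner (X := fun _ => Dv) (B := B * B) hm2
    (fun n => ae_of_all _ fun x => hbb (hLB _) (hχB' _))
    (a' := fun x => L (v x) * deriv χ (ψ x))
    (by
      filter_upwards [hv.tendsto_ae] with x hx
      exact ((hL.continuous.tendsto _).comp hx).mul_const _)
    (fun _ => hv.memLp_grad) (fun n => hψ.memLp_gradient 2)
    hv.memLp_grad (hψ.memLp_gradient 2) (tendsto_eLpNorm_const_sub _ _)
    (tendsto_eLpNorm_const_sub _ _)
  exact tendsto_nhds_unique hl ((hr1.neg.sub hr2).congr fun n => (hn n).symm)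

theorem exists_abs_deriv_le_of_eq_const {L : ℝ → ℝ} (hL : ContDiff ℝ 1 L) {a b A C : ℝ}
    (ha : ∀ s ≤ a, L s = A) (hb : ∀ s, b ≤ s → L s = C) : ∃ B, ∀ s, |deriv L s| ≤ B := by
  obtain ⟨B, hB⟩ := isCompact_Icc.exists_bound_of_continuousOn (s := Icc a b)
    (hL.continuous_deriv le_rfl).continuousOn
  refine ⟨max B 0, fun s => ?_⟩
  rcases lt_or_ge s a with h | h
  · have : L =ᶠ[𝓝 s] fun _ => A := by
      filter_upwards [Iio_mem_nhds h] with t ht using ha t (le_of_lt ht)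
    rw [this.deriv_eq]; simp
  rcases lt_or_ge b s with h' | h'
  · have : L =ᶠ[𝓝 s] fun _ => C := by
      filter_upwards [Ioi_mem_nhds h'] with t ht using hb t (le_of_lt ht)
    rw [this.deriv_eq]; simp
  exact (hB s ⟨h, h'⟩).trans (le_max_left _ _)

/-- The weak Laplacian of `v` tested with `L(v)`, for smooth `L` vanishing on `(-∞,ε]`. -/
theorem IsSobolevApprox.integral_laplacian_mul_comp (hv : IsSobolevApprox Ω v Dv φ)
    (hg : IsWeakLaplacian Ω v g)
    {L : ℝ → ℝ} {B ε : ℝ} (hε : 0 < ε) (hL : ContDiff ℝ ∞ L) (hL0 : ∀ s ≤ ε, L s = 0)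
    (hLB : ∀ s, |L s| ≤ B) (hLB' : ∀ s, |deriv L s| ≤ B)
    (hi : IntegrableOn (fun x => g x * L (v x)) Ω) :
    ∫ x in Ω, g x * L (v x) = -∫ x in Ω, deriv L (v x) * ‖Dv x‖ ^ 2 := by
  -- With `ψ = φ n`, the cutoff `χ (φ n)` tends to `χ v`, which equals 1 wherever `L v ≠ 0`. It is
  -- thus removed in the limit.
  let χ : ℝ → ℝ := fun s => Real.smoothTransition (s / ε)
  have hχ : ContDiff ℝ ∞ χ := Real.smoothTransition.contDiff.comp (contDiff_id.div_const ε)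
  have hχ0 : ∀ s ≤ 0, χ s = 0 := fun s hs =>
    Real.smoothTransition.zero_of_nonpos (div_nonpos_of_nonpos_of_nonneg hs hε.le)
  have hχ1 : ∀ s, ε ≤ s → χ s = 1 := fun s hs =>
    Real.smoothTransition.one_of_one_le ((one_le_div hε).2 hs)
  obtain ⟨B₁, hB₁⟩ := exists_abs_deriv_le_of_eq_const (hχ.of_le (by exact_mod_cast le_top)) hχ0 hχ1
  have hχB : ∀ s, |χ s| ≤ 1 := fun s => by
    rw [abs_of_nonneg (Real.smoothTransition.nonneg _)]
    exact Real.smoothTransition.le_one _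
  let C := max B (max B₁ 1)
  have hCB : B ≤ C := le_max_left _ _
  have hCB₁ : B₁ ≤ C := (le_max_left _ _).trans (le_max_right _ _)
  have hC1 : 1 ≤ C := (le_max_right _ _).trans (le_max_right _ _)
  have hLd : Continuous (deriv L) := hL.continuous_deriv (by exact_mod_cast le_top)
  have hχd : Continuous (deriv χ) := hχ.continuous_deriv (by exact_mod_cast le_top)
  have hcφ : ∀ n, Continuous (φ n) := fun n => (hv.test n).smooth.continuous
  have hbb : ∀ {a b : ℝ}, |a| ≤ C → |b| ≤ C → |a * b| ≤ C * C := fun {a b} ha hb => by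
    rw [abs_mul]; exact mul_le_mul ha hb (abs_nonneg _) (zero_le_one.trans hC1)
  have hn := fun n => hv.integral_laplacian_mul_comp_mul_comp hg (hv.test n) hL hχ
    (hχ0 0 le_rfl) (fun s => (hLB s).trans hCB) (fun s => (hLB' s).trans hCB)
    (fun s => (hχB s).trans hC1) (fun s => (hB₁ s).trans hCB₁)
  -- The compact support is lost here, so the dominating function is `|g * L(v)|`, integrable by
  -- `hi`.
  have hl : Tendsto (fun n => ∫ x in Ω, g x * (L (v x) * χ (φ n x))) atTop
      (𝓝 (∫ x in Ω, g x * (L (v x) * χ (v x)))) := by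
    refine tendsto_integral_of_dominated_convergence (fun x => |g x * L (v x)|)
      (fun n => ?_) hi.abs (fun n => ae_of_all _ fun x => ?_) ?_
    · simp only [← mul_assoc]
      exact hi.aestronglyMeasurable.mul (hχ.continuous.comp (hcφ n)).aestronglyMeasurable
    · rw [← mul_assoc, norm_mul, Real.norm_eq_abs, Real.norm_eq_abs]
      exact mul_le_of_le_one_right (abs_nonneg _) (hχB _)
    · filter_upwards [hv.tendsto_ae] with x hx
      exact ((((hχ.continuous.tendsto _).comp hx).const_mul _).const_mul _)
  have hr1 := tendsto_integral_mul_inner (X := fun _ => Dv) (Y := fun _ => Dv) (B := C * C)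
    (a := fun n x => deriv L (v x) * χ (φ n x))
    (fun n => (hLd.comp_aestronglyMeasurable hv.memLp.1).mul
      (hχ.continuous.comp (hcφ n)).aestronglyMeasurable)
    (fun n => ae_of_all _ fun x => hbb ((hLB' _).trans hCB) ((hχB _).trans hC1))
    (a' := fun x => deriv L (v x) * χ (v x))
    (by
      filter_upwards [hv.tendsto_ae] with x hx
      exact ((hχ.continuous.tendsto _).comp hx).const_mul _)
    (fun _ => hv.memLp_grad) (fun _ => hv.memLp_grad)
    hv.memLp_grad hv.memLp_grad (tendsto_eLpNorm_const_sub _ _) (tendsto_eLpNorm_const_sub _ _)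
  have hr2 := tendsto_integral_mul_inner (X := fun _ => Dv) (B := C * C)
    (a := fun n x => L (v x) * deriv χ (φ n x))
    (fun n => (hL.continuous.comp_aestronglyMeasurable hv.memLp.1).mul
      (hχd.comp (hcφ n)).aestronglyMeasurable)
    (fun n => ae_of_all _ fun x => hbb ((hLB _).trans hCB) ((hB₁ _).trans hCB₁))
    (a' := fun x => L (v x) * deriv χ (v x))
    (by
      filter_upwards [hv.tendsto_ae] with x hx
      exact ((hχd.tendsto _).comp hx).const_mul _)
    (fun _ => hv.memLp_grad) (fun n => (hv.test n).memLp_gradient 2)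
    hv.memLp_grad hv.memLp_grad (tendsto_eLpNorm_const_sub _ _) hv.tendsto_grad
  have hlim := tendsto_nhds_unique hl ((hr1.neg.sub hr2).congr fun n => (hn n).symm)
  have hLχ : ∀ s, L s * χ s = L s := fun s => by
    rcases le_total s ε with h | h
    · rw [hL0 s h, zero_mul]
    · rw [hχ1 s h, mul_one]
  have hLχ1 : ∀ s, deriv L s * χ s = deriv L s := fun s => by
    rcases lt_or_ge s ε with h | h
    · have : L =ᶠ[𝓝 s] fun _ => 0 := by
        filter_upwards [Iio_mem_nhds h] with t ht using hL0 t (le_of_lt ht)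
      rw [this.deriv_eq]; simp
    · rw [hχ1 s h, mul_one]
  -- `L` vanishes up to `ε` and `χ` is constant beyond it, so the cross term disappears.
  have hLχ2 : ∀ s, L s * deriv χ s = 0 := fun s => by
    rcases le_or_gt s ε with h | h
    · rw [hL0 s h, zero_mul]
    · have : χ =ᶠ[𝓝 s] fun _ => 1 := by
        filter_upwards [Ioi_mem_nhds h] with t ht using hχ1 t (le_of_lt ht)
      rw [this.deriv_eq]; simp
  simpa [hLχ, hLχ1, hLχ2, real_inner_self_eq_norm_sq] using hlim

end Sobolev

/-! ### One-sided smoothing of monotone functions. -/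

section Mollification

/-- The mollification of `G` at scale `δ`, shifted to the right by `2δ`. -/
noncomputable def shiftedMollification (G : ℝ → ℝ) (ρ : ContDiffBump (0 : ℝ)) (s : ℝ) : ℝ :=
  convolution (ρ.normed volume) G (ContinuousLinearMap.lsmul ℝ ℝ) volume (s - 2 * ρ.rOut)

variable {G : ℝ → ℝ} (ρ : ContDiffBump (0 : ℝ))

theorem shiftedMollification_eq (s : ℝ) :
    shiftedMollification G ρ s = ∫ y, ρ.normed volume y * G (s - 2 * ρ.rOut - y) := by
  simp [shiftedMollification, convolution_def]

theorem contDiff_shiftedMollification (hG : Continuous G) :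
    ContDiff ℝ ∞ (shiftedMollification G ρ) :=
  (HasCompactSupport.contDiff_convolution_left _ ρ.hasCompactSupport_normed ρ.contDiff_normed
    hG.locallyIntegrable).comp (contDiff_id.sub contDiff_const)

theorem integrable_normed_mul {f : ℝ → ℝ} (hf : Continuous f) :
    Integrable fun y => ρ.normed volume y * f y :=
  (ρ.continuous_normed.mul hf).integrable_of_hasCompactSupport
    ρ.hasCompactSupport_normed.mul_right

theorem integral_normed_mul_mono {f₁ f₂ : ℝ → ℝ} (h₁ : Continuous f₁) (h₂ : Continuous f₂)
    (h : ∀ y, |y| < ρ.rOut → f₁ y ≤ f₂ y) :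
    ∫ y, ρ.normed volume y * f₁ y ≤ ∫ y, ρ.normed volume y * f₂ y := by
  refine integral_mono (integrable_normed_mul ρ h₁) (integrable_normed_mul ρ h₂) fun y => ?_
  by_cases hy : |y| < ρ.rOut
  · exact mul_le_mul_of_nonneg_left (h y hy) (ρ.nonneg_normed y)
  · have : ρ.normed volume y = 0 := by
      rw [← Function.notMem_support, ρ.support_normed_eq]
      simpa using hy
    simp [this]

theorem integral_normed_mul_const (c : ℝ) : ∫ y, ρ.normed volume y * c = c := by
  rw [integral_mul_const, ρ.integral_normed, one_mul]

theorem shiftedMollification_le (hG : Continuous G) {s c : ℝ}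
    (h : ∀ r, s - 3 * ρ.rOut ≤ r → r ≤ s - ρ.rOut → G r ≤ c) : shiftedMollification G ρ s ≤ c := by
  rw [shiftedMollification_eq, ← integral_normed_mul_const ρ c]
  refine integral_normed_mul_mono ρ (by fun_prop) continuous_const fun y hy => ?_
  have := abs_lt.1 hy
  exact h _ (by linarith) (by linarith)

theorem le_shiftedMollification (hG : Continuous G) {s c : ℝ}
    (h : ∀ r, s - 3 * ρ.rOut ≤ r → r ≤ s - ρ.rOut → c ≤ G r) : c ≤ shiftedMollification G ρ s := by
  rw [shiftedMollification_eq, ← integral_normed_mul_const ρ c]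
  refine integral_normed_mul_mono ρ continuous_const (by fun_prop) fun y hy => ?_
  have := abs_lt.1 hy
  exact h _ (by linarith) (by linarith)

theorem shiftedMollification_eq_const (hG : Continuous G) {s c : ℝ}
    (h : ∀ r, s - 3 * ρ.rOut ≤ r → r ≤ s - ρ.rOut → G r = c) : shiftedMollification G ρ s = c :=
  (shiftedMollification_le ρ hG fun r h1 h2 => (h r h1 h2).le).antisymm
    (le_shiftedMollification ρ hG fun r h1 h2 => (h r h1 h2).ge)

/-- Averaging preserves lower bounds on increments, so a bound on the derivative results without
differentiating `G`. -/
theorem le_deriv_shiftedMollification (hG : Continuous G) {s c : ℝ}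
    (h : ∀ a b, s - 3 * ρ.rOut ≤ a → a ≤ b → b ≤ s → c * (b - a) ≤ G b - G a) :
    c ≤ deriv (shiftedMollification G ρ) s := by
  have hd : HasDerivAt (shiftedMollification G ρ) (deriv (shiftedMollification G ρ) s) s :=
    ((contDiff_shiftedMollification ρ hG).differentiable (by simp) s).hasDerivAt
  have hs := hd.tendsto_slope.mono_left (nhdsWithin_mono s (s := Ioi s) fun x hx => ne_of_gt hx)
  refine ge_of_tendsto hs ?_
  have hρ := ρ.rOut_pos
  -- Taking `t < s + ρ.rOut` keeps every translated pair of points inside `[s - 3 * ρ.rOut, s]`.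
  filter_upwards [Ioo_mem_nhdsGT (lt_add_of_pos_right s hρ)] with t ht
  rw [slope_def_field, le_div_iff₀ (sub_pos.2 ht.1), shiftedMollification_eq,
    shiftedMollification_eq, ← integral_sub (integrable_normed_mul ρ (by fun_prop))
      (integrable_normed_mul ρ (by fun_prop)), ← integral_normed_mul_const ρ (c * (t - s))]
  simp only [← mul_sub]
  refine integral_normed_mul_mono ρ continuous_const (by fun_prop) fun y hy => ?_
  have := abs_lt.1 hy
  have := h (s - 2 * ρ.rOut - y) (t - 2 * ρ.rOut - y) (by linarith) (by linarith [ht.1])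
    (by linarith [ht.2])
  refine le_trans (le_of_eq ?_) this
  ring

theorem tendsto_shiftedMollification (hG : Continuous G) {ρ : ℕ → ContDiffBump (0 : ℝ)}
    (hρ : Tendsto (fun n => (ρ n).rOut) atTop (𝓝 0)) (s : ℝ) :
    Tendsto (fun n => shiftedMollification G (ρ n) s) atTop (𝓝 (G s)) := by
  refine ContDiffBump.convolution_tendsto_right hρ
    (Eventually.of_forall fun _ => hG.aestronglyMeasurable)
    ((hG.tendsto s).comp tendsto_snd) ?_
  simpa using tendsto_const_nhds.sub (hρ.const_mul 2)

end Mollification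

/-! ### The energy estimate for nonsmooth `G`. -/

section Energy

variable {N : ℕ} {Ω : Set (Eucl N)} {v g : Eucl N → ℝ}

/-- `k(s - 3δ)` multiplied by a cutoff which vanishes for `s ≤ 3δ` and equals `1` for `s ≥ 4δ`. -/
noncomputable def cutoffShift (k : ℝ → ℝ) (δ s : ℝ) : ℝ :=
  k (s - 3 * δ) * min 1 (max 0 ((s - 3 * δ) / δ))

theorem continuous_cutoffShift {k : ℝ → ℝ} (hk : Continuous k) (δ : ℝ) :
    Continuous (cutoffShift k δ) := by
  unfold cutoffShift
  fun_prop

theorem sq_cutoffShift_le (k : ℝ → ℝ) (δ s : ℝ) : cutoffShift k δ s ^ 2 ≤ k (s - 3 * δ) ^ 2 := by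
  have h0 : 0 ≤ min 1 (max 0 ((s - 3 * δ) / δ)) := le_min zero_le_one (le_max_left _ _)
  have h1 : min 1 (max 0 ((s - 3 * δ) / δ)) ≤ 1 := min_le_left _ _
  rw [cutoffShift, mul_pow]
  exact mul_le_of_le_one_right (sq_nonneg _) (pow_le_one₀ h0 h1)

theorem cutoffShift_of_le {k : ℝ → ℝ} {δ s : ℝ} (hδ : 0 < δ) (hs : s ≤ 3 * δ) :
    cutoffShift k δ s = 0 := by
  rw [cutoffShift, max_eq_left (div_nonpos_of_nonpos_of_nonneg (by linarith) hδ.le),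
    min_eq_right zero_le_one, mul_zero]

theorem cutoffShift_of_ge {k : ℝ → ℝ} {δ s : ℝ} (hδ : 0 < δ) (hs : 4 * δ ≤ s) :
    cutoffShift k δ s = k (s - 3 * δ) := by
  have h1 : 1 ≤ (s - 3 * δ) / δ := (one_le_div hδ).2 (by linarith)
  rw [cutoffShift, max_eq_right (zero_le_one.trans h1), min_eq_left h1, mul_one]

theorem tendsto_cutoffShift {k : ℝ → ℝ} (hk : Continuous k) {δ : ℕ → ℝ} (hδ : ∀ n, 0 < δ n)
    (h : Tendsto δ atTop (𝓝 0)) {s : ℝ} (hs : 0 < s) :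
    Tendsto (fun n => cutoffShift k (δ n) s) atTop (𝓝 (k s)) := by
  have h1 : Tendsto (fun n => k (s - 3 * δ n)) atTop (𝓝 (k s)) := by
    have : Tendsto (fun n => s - 3 * δ n) atTop (𝓝 s) := by
      simpa using tendsto_const_nhds.sub (h.const_mul 3)
    exact (hk.tendsto s).comp this
  refine h1.congr' ?_
  have := h.eventually (gt_mem_nhds (show (0 : ℝ) < s / 4 by positivity))
  filter_upwards [this] with n hn
  exact (cutoffShift_of_ge (hδ n) (by linarith)).symm

/-- The energy estimate: if `G' ≥ η` on `[0,M]` and `k² ≤ C η`, then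
`∫ (∫₀ᵛ k)² ≤ -(2R)² C ∫ G(v) Δv`. -/
theorem integral_sq_primitive_le (hN : 0 < N) {R : ℝ} (hR : Ω ⊆ Metric.closedBall 0 R)
    (hv : MemW012 Ω v) (hg : IsWeakLaplacian Ω v g) {M : ℝ}
    (hv0 : ∀ᵐ x ∂(volume.restrict Ω), 0 ≤ v x) (hvM : ∀ᵐ x ∂(volume.restrict Ω), v x ≤ M)
    {G η k : ℝ → ℝ} {B C : ℝ} (hGc : Continuous G) (hGm : Monotone G) (hG0 : ∀ s ≤ 0, G s = 0)
    (hGM : ∀ s, M ≤ s → G s = G M) (hηm : MonotoneOn η (Icc 0 M))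
    (hη : ∀ a b, 0 ≤ a → a ≤ b → b ≤ M → η a * (b - a) ≤ G b - G a)
    (hk : Continuous k) (hkB : ∀ s, |k s| ≤ B) (hC : 0 ≤ C)
    (hkη : ∀ s ∈ Icc 0 M, k s ^ 2 ≤ C * η s)
    (hi : IntegrableOn (fun x => g x * G (v x)) Ω) :
    ∫ x in Ω, (∫ r in (0 : ℝ)..v x, k r) ^ 2 ≤
      (2 * R) ^ 2 * C * -∫ x in Ω, g x * G (v x) := by
  obtain ⟨Dv, φ, hφ⟩ := hv.exists_approx
  have hfin : IsFiniteMeasure (volume.restrict Ω) :=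
    ⟨by rw [Measure.restrict_apply_univ]
        exact (measure_mono hR).trans_lt measure_closedBall_lt_top⟩
  have hB0 : 0 ≤ B := (abs_nonneg _).trans (hkB 0)
  let δ : ℕ → ℝ := fun n => 1 / ((n : ℝ) + 1)
  have hδ : ∀ n, 0 < δ n := fun n => by positivity
  have hδt : Tendsto δ atTop (𝓝 0) := tendsto_one_div_add_atTop_nhds_zero_nat
  let ρ : ℕ → ContDiffBump (0 : ℝ) := fun n => ⟨δ n / 2, δ n, half_pos (hδ n), half_lt_self (hδ n)⟩
  have hρ : ∀ n, (ρ n).rOut = δ n := fun n => rfl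
  let L : ℕ → ℝ → ℝ := fun n => shiftedMollification G (ρ n)
  have hGnn : ∀ s, 0 ≤ G s := fun s => by
    rcases le_total s 0 with h | h
    · exact (hG0 s h).ge
    · exact (hG0 0 le_rfl).ge.trans (hGm h)
  have hGle : ∀ s, G s ≤ G M := fun s => by
    rcases le_total s M with h | h
    · exact hGm h
    · exact (hGM s h).le
  have hLs : ∀ n, ContDiff ℝ ∞ (L n) := fun n => contDiff_shiftedMollification _ hGc
  -- The shift to the right makes `L n` vanish near 0, as the integration by parts requires, and,
  -- `G` being monotone, keeps `L n ≤ G`, so that `g * G(v)` dominates.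
  have hL0 : ∀ n s, s ≤ δ n → L n s = 0 := fun n s hs =>
    shiftedMollification_eq_const _ hGc fun r _ h2 => hG0 r (by rw [hρ] at h2; linarith)
  have hLM : ∀ n s, M + 3 * δ n ≤ s → L n s = G M := fun n s hs =>
    shiftedMollification_eq_const _ hGc fun r h1 _ => hGM r (by rw [hρ] at h1; linarith)
  have hLnn : ∀ n s, 0 ≤ L n s := fun n s => le_shiftedMollification _ hGc fun r _ _ => hGnn r
  have hLG : ∀ n s, L n s ≤ G s := fun n s => shiftedMollification_le _ hGc fun r _ h2 =>
    hGm (by rw [hρ] at h2; linarith [hδ n])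
  have hLt : ∀ s, Tendsto (fun n => L n s) atTop (𝓝 (G s)) := tendsto_shiftedMollification hGc hδt
  have hLd0 : ∀ n s, 0 ≤ deriv (L n) s := fun n s =>
    le_deriv_shiftedMollification _ hGc fun a b _ hab _ => by
      rw [zero_mul]; exact sub_nonneg.2 (hGm hab)
  have hLd : ∀ n s, 3 * δ n ≤ s → s ≤ M → η (s - 3 * δ n) ≤ deriv (L n) s := fun n s h3 hsM =>
    le_deriv_shiftedMollification _ hGc fun a b ha hab hbs => by
      rw [hρ] at ha
      refine le_trans ?_ (hη a b (by linarith) hab (hbs.trans hsM))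
      refine mul_le_mul_of_nonneg_right (hηm ⟨by linarith, by linarith [hδ n]⟩
        ⟨by linarith, by linarith⟩ ha) (sub_nonneg.2 hab)
  -- Below `3δ` only `deriv (L n) ≥ 0` is available, and there the cutoff vanishes. Above, both
  -- sides are compared through `η (s - 3δ)`.
  have hkL : ∀ n s, s ≤ M → cutoffShift k (δ n) s ^ 2 ≤ C * deriv (L n) s := fun n s hs => by
    rcases le_total s (3 * δ n) with h | h
    · rw [cutoffShift_of_le (hδ n) h]
      simpa using mul_nonneg hC (hLd0 n s)
    · refine (sq_cutoffShift_le k (δ n) s).trans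
        ((hkη _ ⟨by linarith, by linarith [hδ n]⟩).trans ?_)
      exact mul_le_mul_of_nonneg_left (hLd n s h hs) hC
  have hgm := hg.locallyIntegrable_laplacian.aestronglyMeasurable
  have hvm := hφ.memLp.1
  have hLi : ∀ n, IntegrableOn (fun x => g x * L n (v x)) Ω := fun n => by
    refine Integrable.mono hi (hgm.mul ((hLs n).continuous.comp_aestronglyMeasurable hvm))
      (ae_of_all _ fun x => ?_)
    rw [norm_mul, norm_mul, Real.norm_of_nonneg (hLnn n _), Real.norm_of_nonneg (hGnn _)]
    exact mul_le_mul_of_nonneg_left (hLG n _) (norm_nonneg _)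
  let K : ℕ → ℝ → ℝ := fun n s => ∫ r in (0 : ℝ)..s, cutoffShift k (δ n) r
  have hck : ∀ n, Continuous (cutoffShift k (δ n)) := fun n => continuous_cutoffShift hk _
  have hckB : ∀ n s, |cutoffShift k (δ n) s| ≤ B := fun n s => by
    refine le_trans ?_ (hkB (s - 3 * δ n))
    exact sq_le_sq.1 (sq_cutoffShift_le k (δ n) s)
  have hKd : ∀ n s, deriv (K n) s = cutoffShift k (δ n) s := fun n s =>
    Continuous.deriv_integral _ (hck n) 0 s
  have hKdiff : ∀ n, Differentiable ℝ (K n) := fun n s =>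
    (intervalIntegral.integral_hasDerivAt_right ((hck n).intervalIntegrable _ _)
      (hck n).stronglyMeasurable.stronglyMeasurableAtFilter (hck n).continuousAt).differentiableAt
  have hKC : ∀ n, ContDiff ℝ 1 (K n) := fun n => by
    rw [contDiff_one_iff_deriv]
    refine ⟨hKdiff n, ?_⟩
    rw [show deriv (K n) = cutoffShift k (δ n) from funext (hKd n)]
    exact hck n
  have hest : ∀ n, ∫ x in Ω, K n (v x) ^ 2 ≤
      (2 * R) ^ 2 * C * -∫ x in Ω, g x * L n (v x) := by
    intro n
    obtain ⟨B', hB'⟩ := exists_abs_deriv_le_of_eq_const ((hLs n).of_le (by exact_mod_cast le_top))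
      (hL0 n) (hLM n)
    have hLB : ∀ s, |L n s| ≤ G M := fun s => by
      rw [abs_of_nonneg (hLnn n s)]
      exact (hLG n s).trans (hGle s)
    rw [hφ.integral_laplacian_mul_comp (B := max (G M) B') hg (hδ n) (hLs n) (hL0 n)
      (fun s => (hLB s).trans (le_max_left _ _)) (fun s => (hB' s).trans (le_max_right _ _))
      (hLi n), neg_neg]
    refine (hφ.integral_sq_comp_le hN hR (hKC n) (by simp [K])
      (fun s => by rw [hKd]; exact hckB n s)).trans ?_
    rw [mul_assoc, ← integral_const_mul C]
    refine mul_le_mul_of_nonneg_left ?_ (sq_nonneg _)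
    have hDD : Integrable (fun x => ‖Dv x‖ ^ 2) (volume.restrict Ω) := by
      simpa [real_inner_self_eq_norm_sq] using
        integrable_inner_of_memLp hφ.memLp_grad hφ.memLp_grad
    have hLdc : Continuous (deriv (L n)) := (hLs n).continuous_deriv (by exact_mod_cast le_top)
    refine integral_mono_ae ?_ ?_ ?_
    · simp only [hKd]
      exact hDD.bdd_mul (((hck n).pow 2).comp_aestronglyMeasurable hvm) (c := B ^ 2)
        (ae_of_all _ fun x => by
          rw [norm_pow]; exact pow_le_pow_left₀ (norm_nonneg _) (hckB n _) 2)
    · exact (hDD.bdd_mul (hLdc.comp_aestronglyMeasurable hvm) (c := B')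
        (ae_of_all _ fun x => hB' _)).const_mul C
    · filter_upwards [hvM] with x hx
      simp only [hKd]
      rw [← mul_assoc]
      exact mul_le_mul_of_nonneg_right (hkL n _ hx) (sq_nonneg _)
  have hright : Tendsto (fun n => ∫ x in Ω, g x * L n (v x)) atTop
      (𝓝 (∫ x in Ω, g x * G (v x))) := by
    refine tendsto_integral_of_dominated_convergence (fun x => ‖g x * G (v x)‖)
      (fun n => (hLi n).aestronglyMeasurable) hi.norm (fun n => ae_of_all _ fun x => ?_)
      (ae_of_all _ fun x => (hLt _).const_mul _)
    rw [norm_mul, norm_mul, Real.norm_of_nonneg (hLnn n _), Real.norm_of_nonneg (hGnn _)]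
    exact mul_le_mul_of_nonneg_left (hLG n _) (norm_nonneg _)
  have hleft : Tendsto (fun n => ∫ x in Ω, K n (v x) ^ 2) atTop
      (𝓝 (∫ x in Ω, (∫ r in (0 : ℝ)..v x, k r) ^ 2)) := by
    refine tendsto_integral_of_dominated_convergence (fun _ => (B * M) ^ 2)
      (fun n => ((hKC n).continuous.pow 2).comp_aestronglyMeasurable hvm)
      (integrable_const _) (fun n => ?_) ?_
    · filter_upwards [hv0, hvM] with x h0 h1
      rw [norm_pow]
      refine pow_le_pow_left₀ (norm_nonneg _) ?_ 2
      refine (intervalIntegral.norm_integral_le_of_norm_le_const fun r _ => hckB n r).trans ?_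
      rw [sub_zero, abs_of_nonneg h0]
      exact mul_le_mul_of_nonneg_left h1 hB0
    · filter_upwards [hv0] with x h0
      refine Tendsto.pow ?_ 2
      refine intervalIntegral.tendsto_integral_filter_of_dominated_convergence (fun _ => B)
        (Eventually.of_forall fun n => (hck n).aestronglyMeasurable)
        (Eventually.of_forall fun n => ae_of_all _ fun r _ => hckB n r)
        intervalIntegrable_const (ae_of_all _ fun r hr => ?_)
      rw [uIoc_of_le h0] at hr
      exact tendsto_cutoffShift hk hδ hδt hr.1
  exact le_of_tendsto_of_tendsto' hleft (hright.neg.const_mul _) hest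

end Energy

/-! ### The primitive `H` of the weight, and truncation to `[0,M]`. -/

section Weight

variable {h : ℝ → ℝ}

theorem weightPrimitive_zero (h : ℝ → ℝ) : weightPrimitive h 0 = 0 := by simp [weightPrimitive]

theorem IsWeight.intervalIntegrable (hh : IsWeight h) {a b : ℝ} (ha : 0 ≤ a) (hb : 0 ≤ b) :
    IntervalIntegrable h volume a b := by
  have : IntegrableOn h (uIcc a b) := hh.locallyIntegrable.integrableOn_compact_subset
    (fun x hx => (le_min ha hb).trans hx.1) isCompact_uIcc
  exact this.intervalIntegrable

theorem IsWeight.monotoneOn_weightPrimitive (hh : IsWeight h) :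
    MonotoneOn (weightPrimitive h) (Ici 0) := by
  intro a ha b hb hab
  have := intervalIntegral.integral_add_adjacent_intervals
    (hh.intervalIntegrable le_rfl ha) (hh.intervalIntegrable ha hb)
  rw [weightPrimitive, weightPrimitive, ← this]
  refine le_add_of_nonneg_right (intervalIntegral.integral_nonneg_of_ae_restrict hab ?_)
  rw [EventuallyLE, ae_restrict_iff' measurableSet_Icc]
  filter_upwards [Measure.ae_ne volume (0 : ℝ)] with x hx0 hx
  exact (hh.pos x (lt_of_le_of_ne (le_trans ha hx.1) (Ne.symm hx0))).le

theorem IsWeight.weightPrimitive_nonneg (hh : IsWeight h) {s : ℝ} (hs : 0 ≤ s) :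
    0 ≤ weightPrimitive h s := by
  have := hh.monotoneOn_weightPrimitive (mem_Ici.2 le_rfl) hs hs
  rwa [weightPrimitive_zero] at this

theorem IsWeight.continuousOn_weightPrimitive (hh : IsWeight h) :
    ContinuousOn (weightPrimitive h) (Ici 0) := by
  intro x hx
  have hx' : (0 : ℝ) ≤ x + 1 := add_nonneg hx zero_le_one
  have hi : IntegrableOn h (uIcc 0 (x + 1)) := hh.locallyIntegrable.integrableOn_compact_subset
    (fun y hy => by rw [uIcc_of_le hx'] at hy; exact hy.1) isCompact_uIcc
  have hc := intervalIntegral.continuousOn_primitive_interval hi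
  rw [uIcc_of_le hx'] at hc
  refine (hc x ⟨hx, by linarith⟩).mono_of_mem_nhdsWithin ?_
  rw [← Ici_inter_Iic]
  exact inter_mem self_mem_nhdsWithin (mem_nhdsWithin_of_mem_nhds (Iic_mem_nhds (by linarith)))

/-- The projection of `ℝ` onto `[0,M]`. -/
def clampTo (M s : ℝ) : ℝ := max 0 (min s M)

theorem continuous_clampTo (M : ℝ) : Continuous (clampTo M) := by unfold clampTo; fun_prop

theorem clampTo_mem {M : ℝ} (hM : 0 ≤ M) (s : ℝ) : clampTo M s ∈ Icc 0 M :=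
  ⟨le_max_left _ _, max_le hM (min_le_right _ _)⟩

theorem clampTo_of_mem {M s : ℝ} (hs : s ∈ Icc 0 M) : clampTo M s = s := by
  rw [clampTo, min_eq_left hs.2, max_eq_right hs.1]

theorem clampTo_of_nonpos {M s : ℝ} (hM : 0 ≤ M) (hs : s ≤ 0) : clampTo M s = 0 := by
  rw [clampTo, min_eq_left (hs.trans hM), max_eq_left hs]

theorem clampTo_of_ge {M s : ℝ} (hM : 0 ≤ M) (hs : M ≤ s) : clampTo M s = M := by
  rw [clampTo, min_eq_right hs, max_eq_right hM]

theorem monotone_clampTo (M : ℝ) : Monotone (clampTo M) := fun _ _ hab =>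
  max_le_max le_rfl (min_le_min hab le_rfl)

theorem continuous_comp_clampTo {f : ℝ → ℝ} {M : ℝ} (hM : 0 ≤ M) (hf : ContinuousOn f (Icc 0 M)) :
    Continuous fun s => f (clampTo M s) :=
  hf.comp_continuous (continuous_clampTo M) (clampTo_mem hM)

end Weight

/-! ### Jensen's inequality. -/

section Convexity

/-- Jensen's inequality for powers on a set of finite measure. -/
theorem integral_rpow_le {α : Type*} [MeasurableSpace α] (μ : Measure α) [IsFiniteMeasure μ]
    {θ : ℝ} (hθ : 1 < θ) : ∃ V : ℝ, 0 < V ∧ ∀ (f : α → ℝ) (B : ℝ), AEStronglyMeasurable f μ →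
      (∀ᵐ x ∂μ, 0 ≤ f x) → (∀ᵐ x ∂μ, f x ≤ B) →
      (∫ x, f x ∂μ) ^ θ ≤ V * ∫ x, f x ^ θ ∂μ := by
  have hpq := Real.HolderConjugate.conjExponent hθ
  set q := θ.conjExponent
  -- The first summand is Hölder's constant against 1; adding 1 keeps `V` positive even when `μ =
  -- 0`.
  refine ⟨((∫ _, (1 : ℝ) ^ q ∂μ) ^ (1 / q)) ^ θ + 1, by positivity, fun f B hm h0 hB => ?_⟩
  have hmem : MemLp f (ENNReal.ofReal θ) μ := MemLp.of_bound hm B (by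
    filter_upwards [h0, hB] with x h1 h2
    rwa [Real.norm_of_nonneg h1])
  have h := integral_mul_le_Lp_mul_Lq_of_nonneg hpq h0 (ae_of_all _ fun _ => zero_le_one)
    hmem (memLp_const (1 : ℝ) (p := ENNReal.ofReal q))
  simp only [mul_one] at h
  have hI : 0 ≤ ∫ x, f x ^ θ ∂μ := integral_nonneg_of_ae (by
    filter_upwards [h0] with x hx using Real.rpow_nonneg hx _)
  have hV : 0 ≤ (∫ _, (1 : ℝ) ^ q ∂μ) ^ (1 / q) := by positivity
  have h2 := Real.rpow_le_rpow (integral_nonneg_of_ae h0) h (zero_le_one.trans hθ.le)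
  rw [Real.mul_rpow (Real.rpow_nonneg hI _) hV, ← Real.rpow_mul hI,
    one_div_mul_cancel (by linarith), Real.rpow_one] at h2
  nlinarith

end Convexity

/-! ### The dissipation inequality at a fixed time. -/

section EnergyInequality

variable {N : ℕ} {Ω : Set (Eucl N)} {h F : ℝ → ℝ} {γ p : ℝ}

/-- The mean value inequality: away from 0 the one-sided derivative is two-sided, and at 0
continuity suffices. -/
theorem ProductDerivBoundedBelow.mul_sub_le {H : ℝ → ℝ} (hFH : ProductDerivBoundedBelow F H γ)
    {M : ℝ} (hM : 0 < M) : ∃ c₂ : ℝ, 0 < c₂ ∧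
      ContinuousOn (fun r => F r * H r ^ (γ + 1)) (Icc 0 M) ∧
      ∀ a b, 0 ≤ a → a ≤ b → b ≤ M →
        c₂ * (b - a) ≤ F b * H b ^ (γ + 1) - F a * H a ^ (γ + 1) := by
  obtain ⟨c₂, hc₂, hd⟩ := hFH M hM
  have hc : ContinuousOn (fun r => F r * H r ^ (γ + 1)) (Icc 0 M) := fun s hs =>
    (hd s hs).1.continuousWithinAt.mono Icc_subset_Ici_self
  refine ⟨c₂, hc₂, hc, fun a b ha hab hb => ?_⟩
  have hda : ∀ s, 0 < s → s ≤ M →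
      HasDerivAt (fun r => F r * H r ^ (γ + 1))
        (derivWithin (fun r => F r * H r ^ (γ + 1)) (Ici 0) s) s := fun s h0 hs =>
    (hd s ⟨h0.le, hs⟩).1.hasDerivWithinAt.hasDerivAt (Ici_mem_nhds h0)
  refine (convex_Icc a b).mul_sub_le_image_sub_of_le_deriv (hc.mono (Icc_subset_Icc ha hb))
    ?_ ?_ a ⟨le_rfl, hab⟩ b ⟨hab, le_rfl⟩ hab
  · intro s hs
    rw [interior_Icc] at hs
    exact (hda s (ha.trans_lt hs.1) (hs.2.le.trans hb)).differentiableAt.differentiableWithinAt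
  · intro s hs
    rw [interior_Icc] at hs
    rw [(hda s (ha.trans_lt hs.1) (hs.2.le.trans hb)).deriv]
    exact (hd s ⟨(ha.trans_lt hs.1).le, hs.2.le.trans hb⟩).2

/-- A continuous density `k` of the primitive `H^{(p+1+γ)/2}` which satisfies
`k² ≤ C H^{p-γ-1}`. -/
theorem exists_density_rpow (hh : IsWeight h) (hγ : 0 < γ) (hp : γ + 1 ≤ p)
    (hH : PowerDerivBoundedAbove (weightPrimitive h) γ) {M : ℝ} (hM : 0 < M) :
    ∃ (k : ℝ → ℝ) (C : ℝ), 0 < C ∧ ContinuousOn k (Icc 0 M) ∧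
      (∀ s ∈ Icc 0 M, k s ^ 2 ≤ C * weightPrimitive h s ^ (p - γ - 1)) ∧
      ∀ s ∈ Icc 0 M, ∫ r in (0 : ℝ)..s, k r = weightPrimitive h s ^ ((p + 1 + γ) / 2) := by
  obtain ⟨hS, hc₁⟩ := hH
  obtain ⟨c₁, hc₁0, hc₁⟩ := hc₁ M hM
  set H := weightPrimitive h
  let S : ℝ → ℝ := fun s => H s ^ (γ + 1)
  let S' : ℝ → ℝ := derivWithin S (Ici 0)
  -- Chosen so that `S ^ r = H ^ ((p+1+γ)/2)`. The condition `p ≥ γ + 1` is exactly `r ≥ 1`, which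
  -- keeps `S ^ (r - 1)` continuous where `S = 0`.
  let r : ℝ := (p + 1 + γ) / (2 * (γ + 1))
  have hg1 : 0 < γ + 1 := by linarith
  have hr1 : 1 ≤ r := by
    rw [one_le_div (by positivity)]; linarith
  have hH0 : ∀ s, 0 ≤ s → 0 ≤ H s := fun s hs => hh.weightPrimitive_nonneg hs
  have hS0 : ∀ s, 0 ≤ s → 0 ≤ S s := fun s hs => Real.rpow_nonneg (hH0 s hs) _
  have hSm : MonotoneOn S (Ici 0) := fun a ha b hb hab =>
    Real.rpow_le_rpow (hH0 a ha) (hh.monotoneOn_weightPrimitive ha hb hab) hg1.le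
  have hS'0 : ∀ s, 0 ≤ S' s := fun s => hSm.derivWithin_nonneg
  have hS'c : ContinuousOn S' (Ici 0) :=
    hS.continuousOn_derivWithin (uniqueDiffOn_Ici 0) le_rfl
  have hSc : ContinuousOn S (Ici 0) := hS.continuousOn
  have hkc : ContinuousOn (fun s => r * S s ^ (r - 1) * S' s) (Ici 0) :=
    (continuousOn_const.mul (hSc.rpow_const fun s _ => Or.inr (by linarith))).mul hS'c
  refine ⟨fun s => r * S s ^ (r - 1) * S' s, r ^ 2 * c₁ ^ 2, by positivity,
    hkc.mono Icc_subset_Ici_self, ?_, ?_⟩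
  · intro s hs
    have e1 : (S s ^ (r - 1)) ^ 2 = H s ^ (p - γ - 1) := by
      rw [← Real.rpow_natCast, ← Real.rpow_mul (hS0 s hs.1), ← Real.rpow_mul (hH0 s hs.1)]
      congr 1
      simp only [r]
      field_simp
      push_cast
      ring
    have e2 : S' s ^ 2 ≤ c₁ ^ 2 := pow_le_pow_left₀ (hS'0 s) (hc₁ s hs) 2
    calc (r * S s ^ (r - 1) * S' s) ^ 2 = r ^ 2 * H s ^ (p - γ - 1) * S' s ^ 2 := by
          rw [← e1]; ring
      _ ≤ r ^ 2 * H s ^ (p - γ - 1) * c₁ ^ 2 :=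
          mul_le_mul_of_nonneg_left e2 (mul_nonneg (sq_nonneg _) (Real.rpow_nonneg (hH0 s hs.1) _))
      _ = _ := by ring
  · intro s hs
    have hsub : Icc 0 s ⊆ Ici 0 := Icc_subset_Ici_self
    have hF := intervalIntegral.integral_eq_sub_of_hasDerivAt_of_le (f := fun s => S s ^ r)
      (f' := fun s => r * S s ^ (r - 1) * S' s) hs.1
      ((hSc.mono hsub).rpow_const fun s _ => Or.inr (by linarith))
      (fun x hx => by
        have hd : HasDerivAt S (S' x) x :=
          ((hS.differentiableOn one_ne_zero) x hx.1.le).hasDerivWithinAt.hasDerivAt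
            (Ici_mem_nhds hx.1)
        exact (hd.rpow_const (p := r) (Or.inr hr1)).congr_deriv (by ring))
      (ContinuousOn.intervalIntegrable (by
        rw [uIcc_of_le hs.1]; exact hkc.mono hsub))
    rw [hF]
    have hz : S 0 = 0 := by
      simp only [S, H, weightPrimitive_zero]
      exact Real.zero_rpow hg1.ne'
    rw [hz, Real.zero_rpow (by linarith), sub_zero, ← Real.rpow_mul (hH0 s hs.1)]
    congr 1
    simp only [r]
    field_simp

/-- The differential inequality for the energy, at a fixed time. -/
theorem exists_integral_rpow_mul_le (hN : 0 < N) (hΩb : Bornology.IsBounded Ω) (hh : IsWeight h)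
    (hγ : 0 < γ) (hp : γ + 1 ≤ p) (hH : PowerDerivBoundedAbove (weightPrimitive h) γ)
    (hFH : ProductDerivBoundedBelow F (weightPrimitive h) γ) {M : ℝ} (hM : 0 < M) :
    ∃ c : ℝ, 0 < c ∧ ∀ v g : Eucl N → ℝ, MemW012 Ω v → IsWeakLaplacian Ω v g →
      (∀ᵐ x ∂(volume.restrict Ω), 0 ≤ v x) → (∀ᵐ x ∂(volume.restrict Ω), v x ≤ M) →
      MemLp (fun x => F (v x) * g x) 2 (volume.restrict Ω) →
      ∫ x in Ω, weightPrimitive h (v x) ^ p * (F (v x) * g x) ≤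
        -(c * (∫ x in Ω, weightPrimitive h (v x) ^ (p + 1)) ^ ((p + 1 + γ) / (p + 1))) := by
  obtain ⟨R₀, hR₀⟩ := hΩb.subset_closedBall 0
  set R := max R₀ 1
  have hR : Ω ⊆ Metric.closedBall 0 R :=
    hR₀.trans (Metric.closedBall_subset_closedBall (le_max_left _ _))
  have hR0 : 0 < R := zero_lt_one.trans_le (le_max_right _ _)
  have hfin : IsFiniteMeasure (volume.restrict Ω) :=
    ⟨by rw [Measure.restrict_apply_univ]
        exact (measure_mono hR).trans_lt measure_closedBall_lt_top⟩
  obtain ⟨k, C, hC, hkc, hkH, hkI⟩ := exists_density_rpow hh hγ hp hH hM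
  obtain ⟨c₂, hc₂, hPc, hP⟩ := hFH.mul_sub_le hM
  have hp1 : 0 < p + 1 := by linarith
  have hθ : 1 < (p + 1 + γ) / (p + 1) := by rw [one_lt_div hp1]; linarith
  obtain ⟨V, hV, hJ⟩ := integral_rpow_le (volume.restrict Ω) hθ
  set H := weightPrimitive h
  set q := p - γ - 1
  have hq : 0 ≤ q := by simp only [q]; linarith
  have hH0 : ∀ s, 0 ≤ s → 0 ≤ H s := fun s hs => hh.weightPrimitive_nonneg hs
  have hHm := hh.monotoneOn_weightPrimitive
  have hHc : ContinuousOn H (Icc 0 M) := hh.continuousOn_weightPrimitive.mono Icc_subset_Ici_self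
  let P : ℝ → ℝ := fun s => F s * H s ^ (γ + 1)
  have hP0 : P 0 = 0 := by
    simp only [P, H, weightPrimitive_zero]
    rw [Real.zero_rpow (by linarith), mul_zero]
  -- No sign of `F` is assumed; positivity comes from `P 0 = 0` and the growth of `P`.
  have hPnn : ∀ s ∈ Icc 0 M, 0 ≤ P s := fun s hs => by
    have h1 := hP 0 s le_rfl hs.1 hs.2
    have h2 : c₂ * (s - 0) ≤ P s - P 0 := h1
    rw [hP0] at h2
    nlinarith [hs.1, mul_nonneg hc₂.le hs.1]
  have hHq : ∀ a b, 0 ≤ a → a ≤ b → H a ^ q ≤ H b ^ q := fun a b ha hab =>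
    Real.rpow_le_rpow (hH0 a ha) (hHm ha (ha.trans hab) hab) hq
  -- A product rule for increments: the difference is `(P b - P a) H(a)^q + P b (H(b)^q - H(a)^q)`,
  -- whose last term is nonnegative.
  have hGinc : ∀ a b, 0 ≤ a → a ≤ b → b ≤ M →
      c₂ * H a ^ q * (b - a) ≤ P b * H b ^ q - P a * H a ^ q := by
    intro a b ha hab hb
    have h1 : c₂ * (b - a) ≤ P b - P a := hP a b ha hab hb
    have h2 := mul_le_mul_of_nonneg_right h1 (Real.rpow_nonneg (hH0 a ha) q)
    have h3 := mul_le_mul_of_nonneg_left (hHq a b ha hab) (hPnn b ⟨ha.trans hab, hb⟩)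
    nlinarith
  let G : ℝ → ℝ := fun s => P (clampTo M s) * H (clampTo M s) ^ q
  have hHqc : ContinuousOn (fun s => H s ^ q) (Icc 0 M) := hHc.rpow_const fun s _ => Or.inr hq
  have hGc : Continuous G := continuous_comp_clampTo (f := fun s => P s * H s ^ q) hM.le
    (hPc.mul hHqc)
  have hGm : Monotone G := fun a b hab => by
    have hcl := monotone_clampTo M hab
    have h1 := hGinc _ _ (clampTo_mem hM.le a).1 hcl (clampTo_mem hM.le b).2
    have h2 : 0 ≤ c₂ * H (clampTo M a) ^ q * (clampTo M b - clampTo M a) :=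
      mul_nonneg (mul_nonneg hc₂.le (Real.rpow_nonneg (hH0 _ (clampTo_mem hM.le a).1) _))
        (sub_nonneg.2 hcl)
    exact sub_nonneg.1 (h2.trans h1)
  have hGp : ∀ s ∈ Icc 0 M, G s = H s ^ p * F s := fun s hs => by
    simp only [G, P, clampTo_of_mem hs]
    have : H s ^ p = H s ^ (γ + 1) * H s ^ q := by
      rw [← Real.rpow_add_of_nonneg (hH0 s hs.1) (by linarith) hq]
      congr 1; simp only [q]; ring
    rw [this]; ring
  obtain ⟨B, hB⟩ := isCompact_Icc.exists_bound_of_continuousOn hkc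
  -- `V` comes from Jensen, `(2R)²` from Poincaré, and `C / c₂` compares `k²` with the increment
  -- rate `c₂ H^q` of `G`.
  refine ⟨1 / (V * ((2 * R) ^ 2 * (C / c₂))), by positivity, fun v g hv hg hv0 hvM hFg => ?_⟩
  have hvI : ∀ᵐ x ∂(volume.restrict Ω), v x ∈ Icc 0 M := by
    filter_upwards [hv0, hvM] with x h0 h1 using ⟨h0, h1⟩
  have hvm := hv.1.1
  have hHpm : ∀ e : ℝ, 0 ≤ e → AEStronglyMeasurable (fun x => H (v x) ^ e)
      (volume.restrict Ω) := fun e he => by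
    refine ((continuous_comp_clampTo (f := fun s => H s ^ e) hM.le
      (hHc.rpow_const fun s _ => Or.inr he)).comp_aestronglyMeasurable hvm).congr ?_
    filter_upwards [hvI] with x hx
    simp only [clampTo_of_mem hx]
  have hHb : ∀ e : ℝ, 0 ≤ e → ∀ᵐ x ∂(volume.restrict Ω), H (v x) ^ e ≤ H M ^ e := fun e he => by
    filter_upwards [hvI] with x hx
    exact Real.rpow_le_rpow (hH0 _ hx.1) (hHm hx.1 hM.le hx.2) he
  have hae : (fun x => H (v x) ^ p * (F (v x) * g x)) =ᵐ[volume.restrict Ω]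
      fun x => g x * G (v x) := by
    filter_upwards [hvI] with x hx
    rw [hGp _ hx]; ring
  have hi : IntegrableOn (fun x => g x * G (v x)) Ω := by
    refine Integrable.congr ?_ hae
    refine (hFg.integrable (by norm_num)).bdd_mul (hHpm p (by linarith)) (c := H M ^ p) ?_
    filter_upwards [hvI, hHb p (by linarith)] with x hx hx'
    rwa [Real.norm_of_nonneg (Real.rpow_nonneg (hH0 _ hx.1) _)]
  have hmain := integral_sq_primitive_le hN hR hv hg hv0 hvM hGc hGm
    (fun s hs => by simp only [G, clampTo_of_nonpos hM.le hs, hP0, zero_mul])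
    (fun s hs => by simp only [G, clampTo_of_ge hM.le hs, clampTo_of_ge hM.le le_rfl])
    (η := fun s => c₂ * H s ^ q)
    (fun a ha b _ hab => mul_le_mul_of_nonneg_left (hHq a b ha.1 hab) hc₂.le)
    (fun a b ha hab hb => by
      simp only [G, clampTo_of_mem (⟨ha, hab.trans hb⟩ : a ∈ Icc 0 M),
        clampTo_of_mem (⟨ha.trans hab, hb⟩ : b ∈ Icc 0 M)]
      exact hGinc a b ha hab hb)
    (continuous_comp_clampTo hM.le hkc) (fun s => hB _ (clampTo_mem hM.le s))
    (C := C / c₂) (by positivity)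
    (fun s hs => by
      rw [clampTo_of_mem hs]
      refine (hkH s hs).trans (le_of_eq ?_)
      field_simp)
    hi
  have hsq : (fun x => (∫ r in (0 : ℝ)..v x, k (clampTo M r)) ^ 2) =ᵐ[volume.restrict Ω]
      fun x => (H (v x) ^ (p + 1)) ^ ((p + 1 + γ) / (p + 1)) := by
    filter_upwards [hvI] with x hx
    have : ∫ r in (0 : ℝ)..v x, k (clampTo M r) = ∫ r in (0 : ℝ)..v x, k r := by
      refine intervalIntegral.integral_congr fun r hr => ?_
      rw [uIcc_of_le hx.1] at hr
      simp only [clampTo_of_mem (⟨hr.1, hr.2.trans hx.2⟩ : r ∈ Icc 0 M)]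
    rw [this, hkI _ hx, ← Real.rpow_natCast, ← Real.rpow_mul (hH0 _ hx.1),
      ← Real.rpow_mul (hH0 _ hx.1)]
    congr 1
    field_simp
    push_cast
    ring
  rw [integral_congr_ae hsq] at hmain
  rw [integral_congr_ae hae]
  have hj := hJ (fun x => H (v x) ^ (p + 1)) (H M ^ (p + 1)) (hHpm _ hp1.le)
    (by filter_upwards [hvI] with x hx using Real.rpow_nonneg (hH0 _ hx.1) _) (hHb _ hp1.le)
  have hfinal := hj.trans (mul_le_mul_of_nonneg_left hmain hV.le)
  rw [le_neg, one_div, inv_mul_le_iff₀ (by positivity)]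
  refine hfinal.trans (le_of_eq ?_)
  ring

end EnergyInequality

/-! ### Absolute continuity and powers of primitives. -/

section AbsolutelyContinuous

theorem AbsolutelyContinuousOnInterval.of_dist_le {f g : ℝ → ℝ} {a b K : ℝ}
    (hf : AbsolutelyContinuousOnInterval f a b)
    (h : ∀ x ∈ uIcc a b, ∀ y ∈ uIcc a b, dist (g x) (g y) ≤ K * dist (f x) (f y)) :
    AbsolutelyContinuousOnInterval g a b := by
  have hK : Tendsto _ _ (𝓝 (K * 0)) := Tendsto.const_mul K hf
  rw [mul_zero] at hK
  refine squeeze_zero' (Eventually.of_forall fun E => Finset.sum_nonneg fun _ _ => dist_nonneg)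
    ?_ hK
  filter_upwards [mem_inf_of_right (mem_principal_self _)] with E hE
  rw [Finset.mul_sum]
  exact Finset.sum_le_sum fun i hi => h _ (hE.1 i hi).1 _ (hE.1 i hi).2

/-- The chain rule for a power of a primitive, in integrated form. -/
theorem rpow_primitive_sub_eq_integral {f : ℝ → ℝ} {a b z₀ e : ℝ} (he : 1 ≤ e)
    (hf : IntervalIntegrable f volume a b) :
    (z₀ + ∫ s in a..b, f s) ^ e - z₀ ^ e =
      ∫ t in a..b, e * (z₀ + ∫ s in a..t, f s) ^ (e - 1) * f t := by
  let z : ℝ → ℝ := fun t => z₀ + ∫ s in a..t, f s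
  have hac := hf.absolutelyContinuousOnInterval_intervalIntegral (c := a) left_mem_uIcc
  have hz : AbsolutelyContinuousOnInterval z a b :=
    hac.of_dist_le (K := 1) fun x _ y _ => by simp [z]
  -- For `e ≥ 1` the power is Lipschitz on the compact range of `z`, so `z ^ e` is absolutely
  -- continuous and is recovered from its almost everywhere derivative.
  have hloc : LocallyLipschitzOn (z '' uIcc a b) fun x : ℝ => x ^ e :=
    (ContDiff.locallyLipschitz (𝕂 := ℝ) (by
      simpa using Real.contDiff_rpow_const_of_le (p := e) (n := 1)
        (by simpa using he))).locallyLipschitzOn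
  obtain ⟨K, hK⟩ := hloc.exists_lipschitzOnWith_of_compact
    (isCompact_uIcc.image_of_continuousOn hz.continuousOn)
  have hze : AbsolutelyContinuousOnInterval (fun t => z t ^ e) a b :=
    hz.of_dist_le (K := K) fun x hx y hy =>
      hK.dist_le_mul _ (mem_image_of_mem _ hx) _ (mem_image_of_mem _ hy)
  have h := hze.integral_deriv_eq_sub
  have hza : z a = z₀ := by simp [z]
  rw [show z₀ + ∫ s in a..b, f s = z b from rfl, ← congrArg (· ^ e) hza]
  rw [← h]
  refine intervalIntegral.integral_congr_ae ?_
  filter_upwards [hf.ae_hasDerivAt_integral] with t ht hm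
  have hd : HasDerivAt z (f t) t := (ht (uIoc_subset_uIcc hm) a left_mem_uIcc).const_add z₀
  rw [(hd.rpow_const (p := e) (Or.inr he)).deriv]
  simp only [z]
  ring

end AbsolutelyContinuous

/-! ### Differentiation in time under the spatial integral. -/

section TimeDerivative

variable {α : Type*} [MeasurableSpace α] {ν : Measure α} [IsFiniteMeasure ν]

/-- A function on the time-space product whose value at time `t` is `z₀ + ∫_{t₀}^t w`. -/
noncomputable def timePrimitive (t₀ : ℝ) (z₀ : α → ℝ) (w : ℝ × α → ℝ) (t : ℝ) (x : α) : ℝ :=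
  z₀ x + ∫ s in Ioc t₀ t, w (s, x)

theorem measurable_timePrimitive (t₀ : ℝ) {z₀ : α → ℝ} {w : ℝ × α → ℝ}
    (hz : Measurable z₀) (hw : StronglyMeasurable w) :
    Measurable (Function.uncurry (timePrimitive t₀ z₀ w)) := by
  -- Writing the variable upper limit as an indicator in a third variable reduces joint
  -- measurability to that of parametric integrals.
  have h1 : StronglyMeasurable fun q : (ℝ × α) × ℝ =>
      {q : (ℝ × α) × ℝ | t₀ < q.2 ∧ q.2 ≤ q.1.1}.indicator (fun q => w (q.2, q.1.2)) q := by
    refine StronglyMeasurable.indicator (hw.comp_measurable (by fun_prop)) ?_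
    exact (measurableSet_lt measurable_const measurable_snd).inter
      (measurableSet_le measurable_snd (by fun_prop))
  have h2 := h1.integral_prod_right' (ν := volume)
  have h3 : (fun q : ℝ × α => ∫ s in Ioc t₀ q.1, w (s, q.2)) = fun q : ℝ × α =>
      ∫ s, {q : (ℝ × α) × ℝ | t₀ < q.2 ∧ q.2 ≤ q.1.1}.indicator
        (fun q => w (q.2, q.1.2)) (q, s) := by
    funext q
    rw [← integral_indicator measurableSet_Ioc]
    rfl
  exact (hz.comp measurable_snd).add (h3 ▸ h2.measurable)

variable {t₀ K : ℝ} {U w : ℝ → α → ℝ}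

/-- Differentiation of `∫ U(t)^e` under the integral sign, for a bounded nonnegative function `U`
with time derivative `w ∈ L²`. -/
theorem exists_integral_rpow_eq {e : ℝ} (he : 1 ≤ e)
    (hw : MemLp (Function.uncurry w) 2 ((volume.restrict (Ioi t₀)).prod ν))
    (hU : ∀ t, t₀ ≤ t → ∀ᵐ x ∂ν, U t x = U t₀ x + ∫ s in t₀..t, w s x)
    (hU₀ : AEStronglyMeasurable (U t₀) ν) (hU0 : ∀ t, t₀ ≤ t → ∀ᵐ x ∂ν, 0 ≤ U t x)
    (hUK : ∀ t, t₀ < t → ∀ᵐ x ∂ν, U t x ≤ K) :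
    (∀ t, t₀ ≤ t → Integrable (fun x => U t x ^ e) ν) ∧
    (∀ᵐ t ∂(volume.restrict (Ioi t₀)), Integrable (w t) ν) ∧
    ∃ y : ℝ → ℝ, (∀ t, t₀ ≤ t → IntervalIntegrable y volume t₀ t) ∧
      (∀ t, t₀ ≤ t → ∫ x, U t x ^ e ∂ν = ∫ x, U t₀ x ^ e ∂ν + ∫ s in t₀..t, y s) ∧
      ∀ᵐ t ∂(volume.restrict (Ioi t₀)), y t = e * ∫ x, U t x ^ (e - 1) * w t x ∂ν := by
  have he0 : 0 ≤ e := zero_le_one.trans he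
  let w' : ℝ × α → ℝ := hw.1.mk _
  have hw'm : StronglyMeasurable w' := hw.1.stronglyMeasurable_mk
  have hww : Function.uncurry w =ᵐ[(volume.restrict (Ioi t₀)).prod ν] w' := hw.1.ae_eq_mk
  have hw' : MemLp w' 2 ((volume.restrict (Ioi t₀)).prod ν) := hw.ae_eq hww
  have hsub : ∀ t, volume.restrict (Ioc t₀ t) ≤ volume.restrict (Ioi t₀) := fun t =>
    Measure.restrict_mono Ioc_subset_Ioi_self le_rfl
  have hstrip : ∀ t, Integrable w' ((volume.restrict (Ioc t₀ t)).prod ν) := fun t =>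
    (hw'.mono_measure (Measure.prod_mono (hsub t) le_rfl)).integrable (by norm_num)
  have hww1 : ∀ᵐ s ∂(volume.restrict (Ioi t₀)), ∀ᵐ x ∂ν, w s x = w' (s, x) :=
    Measure.ae_ae_of_ae_prod hww
  have hww2 : ∀ᵐ x ∂ν, ∀ᵐ s ∂(volume.restrict (Ioi t₀)), w s x = w' (s, x) :=
    Measure.ae_ae_of_ae_prod (Measure.measurePreserving_swap.quasiMeasurePreserving.ae hww)
  let z₀ : α → ℝ := hU₀.mk _
  have hz₀m : Measurable z₀ := hU₀.stronglyMeasurable_mk.measurable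
  -- Fubini needs joint measurability, which is not assumed of `U`; `z` has it and agrees with `U`
  -- almost everywhere at each time.
  let z := timePrimitive t₀ z₀ w'
  have hzm : Measurable (Function.uncurry z) := measurable_timePrimitive t₀ hz₀m hw'm
  have hUz : ∀ t, t₀ ≤ t → ∀ᵐ x ∂ν, U t x = z t x := fun t ht => by
    filter_upwards [hU t ht, hww2, hU₀.ae_eq_mk] with x h1 h2 h3
    rw [h1, h3, intervalIntegral.integral_of_le ht]
    exact congrArg _ (integral_congr_ae (ae_restrict_of_ae_restrict_of_subset
      Ioc_subset_Ioi_self h2))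
  have hxi : ∀ᵐ x ∂ν, ∀ n : ℕ, IntegrableOn (fun s => w' (s, x)) (Ioc t₀ (t₀ + n)) := by
    rw [ae_all_iff]
    exact fun n => (hstrip _).prod_left_ae
  have hxi' : ∀ᵐ x ∂ν, ∀ t, t₀ ≤ t → IntervalIntegrable (fun s => w' (s, x)) volume t₀ t := by
    filter_upwards [hxi] with x hx t ht
    obtain ⟨n, hn⟩ := exists_nat_ge (t - t₀)
    rw [intervalIntegrable_iff_integrableOn_Ioc_of_le ht]
    exact (hx n).mono_set (Ioc_subset_Ioc_right (by linarith))
  have hz₀z : ∀ x, z t₀ x = z₀ x := fun x => by simp [z, timePrimitive]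
  -- The bound is assumed only after `t₀`; it extends to `t₀` by continuity in time, along a
  -- sequence so that the exceptional null sets stay countable.
  have hzK₀ : ∀ᵐ x ∂ν, z t₀ x ≤ K := by
    have h1 : ∀ᵐ x ∂ν, ∀ n : ℕ, z (t₀ + 1 / ((n : ℝ) + 1)) x ≤ K := by
      rw [ae_all_iff]
      intro n
      have hn : t₀ < t₀ + 1 / ((n : ℝ) + 1) := by
        have : 0 < 1 / ((n : ℝ) + 1) := by positivity
        linarith
      filter_upwards [hUz _ hn.le, hUK _ hn] with x h2 h3
      rwa [← h2]
    filter_upwards [h1, hxi'] with x h2 h3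
    have hc := (h3 (t₀ + 1) (by linarith)).absolutelyContinuousOnInterval_intervalIntegral
      (c := t₀) left_mem_uIcc |>.continuousOn
    have hc0 := hc t₀ left_mem_uIcc
    have htt : Tendsto (fun n : ℕ => t₀ + 1 / ((n : ℝ) + 1)) atTop
        (𝓝[uIcc t₀ (t₀ + 1)] t₀) := by
      refine tendsto_nhdsWithin_iff.2 ⟨?_, Eventually.of_forall fun n => ?_⟩
      · simpa using tendsto_const_nhds.add (tendsto_one_div_add_atTop_nhds_zero_nat (𝕜 := ℝ))
      · rw [uIcc_of_le (by linarith)]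
        have h4 : 0 < 1 / ((n : ℝ) + 1) := by positivity
        have h5 : 1 / ((n : ℝ) + 1) ≤ 1 := by
          rw [div_le_one (by positivity)]
          linarith [n.cast_nonneg (α := ℝ)]
        exact ⟨by linarith, by linarith⟩
    have hlim := (hc0.tendsto.comp htt).const_add (z₀ x)
    rw [intervalIntegral.integral_same, add_zero] at hlim
    rw [hz₀z]
    refine le_of_tendsto' hlim fun n => ?_
    have h6 := h2 n
    have h4 : 0 < 1 / ((n : ℝ) + 1) := by positivity
    simp only [Function.comp]
    rwa [intervalIntegral.integral_of_le (by linarith)]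
  have hzb : ∀ t, t₀ ≤ t → ∀ᵐ x ∂ν, 0 ≤ z t x ∧ z t x ≤ K := fun t ht => by
    rcases ht.eq_or_lt with rfl | h
    · filter_upwards [hzK₀, hU0 _ le_rfl, hUz _ le_rfl] with x h1 h2 h3
      exact ⟨h3 ▸ h2, h1⟩
    · filter_upwards [hUK _ h, hU0 _ h.le, hUz _ h.le] with x h1 h2 h3
      exact ⟨h3 ▸ h2, h3 ▸ h1⟩
  have hpow : ∀ {a : ℝ}, 0 ≤ a → ∀ {s : ℝ}, 0 ≤ s ∧ s ≤ K → ‖s ^ a‖ ≤ K ^ a :=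
    fun {a} ha {s} hs => by
      rw [Real.norm_of_nonneg (Real.rpow_nonneg hs.1 _)]
      exact Real.rpow_le_rpow hs.1 hs.2 ha
  have hzi : ∀ t, t₀ ≤ t → Integrable (fun x => z t x ^ e) ν := fun t ht => by
    refine Integrable.of_bound (C := K ^ e)
      ((hzm.comp measurable_prodMk_left).pow_const e).aestronglyMeasurable ?_
    filter_upwards [hzb t ht] with x hx using hpow he0 hx
  have hUze : ∀ t, t₀ ≤ t → (fun x => U t x ^ e) =ᵐ[ν] fun x => z t x ^ e := fun t ht => by
    filter_upwards [hUz t ht] with x hx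
    rw [hx]
  -- On a strip of finite measure `w' ∈ L²` is integrable and the remaining factor is bounded; this
  -- licenses the exchange of integrals below.
  have hzprod : ∀ t, Integrable (fun q : ℝ × α => e * z q.1 q.2 ^ (e - 1) * w' q)
      ((volume.restrict (Ioc t₀ t)).prod ν) := fun t => by
    refine (hstrip t).bdd_mul (c := e * K ^ (e - 1))
      ((hzm.pow_const _).const_mul e).aestronglyMeasurable ?_
    have hset : MeasurableSet {q : ℝ × α | 0 ≤ z q.1 q.2 ∧ z q.1 q.2 ≤ K} :=
      (measurableSet_le measurable_const hzm).inter (measurableSet_le hzm measurable_const)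
    have hae : ∀ᵐ q ∂((volume.restrict (Ioc t₀ t)).prod ν), 0 ≤ z q.1 q.2 ∧ z q.1 q.2 ≤ K := by
      refine (Measure.ae_prod_iff_ae_ae hset).2 ?_
      filter_upwards [ae_restrict_mem measurableSet_Ioc] with s hs
      exact hzb s hs.1.le
    filter_upwards [hae] with q hq
    rw [norm_mul, Real.norm_of_nonneg he0]
    exact mul_le_mul_of_nonneg_left (hpow (by linarith) hq) he0
  refine ⟨fun t ht => (hzi t ht).congr (hUze t ht).symm, ?_,
    fun s => ∫ x, e * z s x ^ (e - 1) * w' (s, x) ∂ν, ?_, ?_, ?_⟩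
  · have h1 : ∀ᵐ t ∂(volume.restrict (Ioi t₀)), Integrable (fun x => w' (t, x)) ν := by
      have h2 : ∀ᵐ t ∂(volume.restrict (Ioi t₀)), Integrable (fun x => w' (t, x) ^ 2) ν :=
        hw'.integrable_sq.prod_right_ae
      filter_upwards [h2] with t ht
      refine ((memLp_two_iff_integrable_sq ?_).2 ht).integrable (by norm_num)
      exact (hw'm.comp_measurable measurable_prodMk_left).aestronglyMeasurable
    filter_upwards [h1, hww1] with t h2 h3
    exact h2.congr (by filter_upwards [h3] with x hx using hx.symm)
  · intro t ht
    rw [intervalIntegrable_iff_integrableOn_Ioc_of_le ht]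
    exact (hzprod t).integral_prod_left
  · intro t ht
    rw [integral_congr_ae (hUze t ht), integral_congr_ae (hUze t₀ le_rfl), ← sub_eq_iff_eq_add',
      ← integral_sub (hzi t ht) (hzi t₀ le_rfl), intervalIntegral.integral_of_le ht,
      integral_integral_swap (f := fun s x => e * z s x ^ (e - 1) * w' (s, x)) (hzprod t)]
    refine integral_congr_ae ?_
    filter_upwards [hxi'] with x hx
    have h := rpow_primitive_sub_eq_integral (z₀ := z₀ x) he (hx t ht)
    rw [intervalIntegral.integral_of_le ht, intervalIntegral.integral_of_le ht] at h
    rw [hz₀z]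
    refine h.trans (setIntegral_congr_fun measurableSet_Ioc fun s hs => ?_)
    simp only [z, timePrimitive]
    rw [intervalIntegral.integral_of_le hs.1.le]
  · filter_upwards [hww1, ae_restrict_mem measurableSet_Ioi] with t h1 ht
    rw [← integral_const_mul]
    refine integral_congr_ae ?_
    filter_upwards [h1, hUz t (le_of_lt ht)] with x h2 h3
    rw [h2, h3, mul_assoc]

end TimeDerivative

/-! ### Decay from an integrated differential inequality. -/

section Decay

/-- The convex function `r ↦ r^(-β)` lies above its tangent at `x`; after scaling to `y / x` this
follows from `log r ≤ r - 1` and `1 + a ≤ exp a`. -/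
theorem mul_sub_le_rpow_neg_sub_rpow_neg {β x y : ℝ} (hβ : 0 ≤ β) (hy : 0 < y) (hyx : y ≤ x) :
    β * x ^ (-β - 1) * (x - y) ≤ y ^ (-β) - x ^ (-β) := by
  have hx : 0 < x := hy.trans_le hyx
  have hr : 0 < y / x := div_pos hy hx
  have h1 : 1 + β * (1 - y / x) ≤ (y / x) ^ (-β) := by
    rw [Real.rpow_def_of_pos hr]
    have h2 := Real.add_one_le_exp (Real.log (y / x) * -β)
    have h3 := mul_le_mul_of_nonneg_left (Real.log_le_sub_one_of_pos hr) hβ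
    linarith
  have h4 : y ^ (-β) = x ^ (-β) * (y / x) ^ (-β) := by
    rw [← Real.mul_rpow hx.le hr.le, mul_div_cancel₀ _ hx.ne']
  have h5 : x ^ (-β - 1) * (x - y) = x ^ (-β) * (1 - y / x) := by
    rw [Real.rpow_sub_one hx.ne']
    field_simp
  rw [mul_assoc, h5, h4]
  nlinarith [mul_le_mul_of_nonneg_left h1 (Real.rpow_nonneg hx.le (-β))]

variable {Y : ℝ → ℝ} {t₀ c β : ℝ}

/-- The hypothesis `hY`, shared by the lemmas below, is an implicit Euler form of `Y' ≤ -c Y^(1+β)`.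
It holds for all pairs of times, so exceptional null sets play no role. -/
theorem antitoneOn_of_add_mul_rpow_le (hc : 0 ≤ c) (hY0 : ∀ t, t₀ ≤ t → 0 ≤ Y t)
    (hY : ∀ a b, t₀ ≤ a → a ≤ b → Y b + c * (b - a) * Y b ^ (1 + β) ≤ Y a) :
    AntitoneOn Y (Ici t₀) := by
  intro a ha b hb hab
  have := hY a b ha hab
  have h2 : 0 ≤ c * (b - a) * Y b ^ (1 + β) :=
    mul_nonneg (mul_nonneg hc (sub_nonneg.2 hab)) (Real.rpow_nonneg (hY0 b hb) _)
  linarith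

theorem deriv_add_mul_rpow_le (hβ : 0 ≤ β)
    (hY : ∀ a b, t₀ ≤ a → a ≤ b → Y b + c * (b - a) * Y b ^ (1 + β) ≤ Y a)
    {t : ℝ} (ht : t₀ < t) (hd : DifferentiableAt ℝ Y t) : deriv Y t + c * Y t ^ (1 + β) ≤ 0 := by
  have hs := hd.hasDerivAt.tendsto_slope.mono_left
    (nhdsWithin_mono t (s := Ioi t) fun x hx => ne_of_gt hx)
  have hr : Tendsto (fun b => c * Y b ^ (1 + β)) (𝓝[>] t) (𝓝 (c * Y t ^ (1 + β))) :=
    ((hd.continuousAt.tendsto.mono_left nhdsWithin_le_nhds).rpow_const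
      (Or.inr (by linarith))).const_mul c
  refine le_of_tendsto (hs.add hr) ?_
  filter_upwards [self_mem_nhdsWithin] with b hb
  have hb' : 0 < b - t := sub_pos.2 hb
  have h := hY t b ht.le (le_of_lt hb)
  have : slope Y t b ≤ -(c * Y b ^ (1 + β)) := by
    rw [slope_def_field, div_le_iff₀ hb']
    nlinarith
  linarith

theorem le_rpow_of_add_mul_rpow_le (hc : 0 < c) (hβ : 0 < β) (hY0 : ∀ t, t₀ ≤ t → 0 ≤ Y t)
    (hYc : ContinuousOn Y (Ici t₀))
    (hY : ∀ a b, t₀ ≤ a → a ≤ b → Y b + c * (b - a) * Y b ^ (1 + β) ≤ Y a)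
    (hpos : 0 < Y t₀) {t : ℝ} (ht : t₀ ≤ t) :
    Y t ≤ (c * β * (t - t₀) + Y t₀ ^ (-β)) ^ (-(1 / β)) := by
  have hA : 0 < c * β * (t - t₀) + Y t₀ ^ (-β) :=
    add_pos_of_nonneg_of_pos (mul_nonneg (by positivity) (sub_nonneg.2 ht))
      (Real.rpow_pos_of_pos hpos _)
  rcases (hY0 t ht).eq_or_lt with h0 | hYt
  · rw [← h0]
    exact Real.rpow_nonneg hA.le _
  have hanti := antitoneOn_of_add_mul_rpow_le hc.le hY0 hY
  have hYp : ∀ s ∈ Icc t₀ t, 0 < Y s := fun s hs =>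
    hYt.trans_le (hanti hs.1 ht hs.2)
  -- `-Y^(-β)` is compared with a line of slope `-cβ`: the tangent inequality and `hY` bound the
  -- right slopes at `x` by `-cβ Y(x)^(-β-1) Y(z)^(1+β)`, which tends to `-cβ` as `z → x`.
  have hcomp := image_le_of_liminf_slope_right_le_deriv_boundary (f := fun s => -(Y s ^ (-β)))
    (a := t₀) (b := t) (B := fun s => -(Y t₀ ^ (-β)) - c * β * (s - t₀)) (B' := fun _ => -(c * β))
    ((hYc.mono Icc_subset_Ici_self).rpow_const fun s hs => Or.inl (hYp s hs).ne').neg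
    (by simp) (by fun_prop)
    (fun x _ => by
      have : HasDerivAt (fun s => -(Y t₀ ^ (-β)) - c * β * (s - t₀)) (-(c * β)) x := by
        simpa using (((hasDerivAt_id x).sub_const t₀).const_mul (c * β)).const_sub (-(Y t₀ ^ (-β)))
      exact this.hasDerivWithinAt)
    (fun x hx r hr => by
      have hYx : 0 < Y x := hYp x ⟨hx.1, hx.2.le⟩
      have hlim : Tendsto (fun z => -(c * β * (Y x ^ (-β - 1) * Y z ^ (1 + β)))) (𝓝[>] x)
          (𝓝 (-(c * β * (Y x ^ (-β - 1) * Y x ^ (1 + β))))) := by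
        have hcx : Tendsto Y (𝓝[>] x) (𝓝 (Y x)) :=
          ((hYc x hx.1).mono (fun z hz => le_trans hx.1 (le_of_lt hz)))
        exact (((hcx.rpow_const (Or.inl hYx.ne')).const_mul _).const_mul _).neg
      have hone : Y x ^ (-β - 1) * Y x ^ (1 + β) = 1 := by
        rw [← Real.rpow_add hYx, show -β - 1 + (1 + β) = 0 by ring, Real.rpow_zero]
      rw [hone, mul_one] at hlim
      refine Eventually.frequently ?_
      filter_upwards [hlim.eventually (gt_mem_nhds hr), Ioo_mem_nhdsGT hx.2] with z hz hzI
      refine lt_of_le_of_lt ?_ hz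
      have hzx : 0 < z - x := sub_pos.2 hzI.1
      have hzt : z ∈ Icc t₀ t := ⟨hx.1.trans hzI.1.le, hzI.2.le⟩
      have h1 := mul_sub_le_rpow_neg_sub_rpow_neg hβ.le (hYp z hzt)
        (hanti hx.1 hzt.1 hzI.1.le)
      have h2 := hY x z hx.1 hzI.1.le
      have h3 : β * Y x ^ (-β - 1) * (c * (z - x) * Y z ^ (1 + β)) ≤
          β * Y x ^ (-β - 1) * (Y x - Y z) :=
        mul_le_mul_of_nonneg_left (by linarith)
          (mul_nonneg hβ.le (Real.rpow_nonneg hYx.le _))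
      rw [slope_def_field, div_le_iff₀ hzx]
      nlinarith)
  have hfin := hcomp (right_mem_Icc.2 ht)
  have hle : c * β * (t - t₀) + Y t₀ ^ (-β) ≤ Y t ^ (-β) := by linarith
  have h := Real.rpow_le_rpow_of_nonpos hA hle (z := -(1 / β)) (by
    have : 0 < 1 / β := by positivity
    linarith)
  rwa [← Real.rpow_mul hYt.le, neg_mul_neg, mul_one_div_cancel hβ.ne', Real.rpow_one] at h

theorem tendsto_zero_of_add_mul_rpow_le (hc : 0 < c) (hβ : 0 < β) (hY0 : ∀ t, t₀ ≤ t → 0 ≤ Y t)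
    (hYc : ContinuousOn Y (Ici t₀))
    (hY : ∀ a b, t₀ ≤ a → a ≤ b → Y b + c * (b - a) * Y b ^ (1 + β) ≤ Y a) :
    Tendsto Y atTop (𝓝 0) := by
  rcases (hY0 t₀ le_rfl).eq_or_lt with h0 | hpos
  · refine tendsto_const_nhds.congr' ?_
    filter_upwards [eventually_ge_atTop t₀] with t ht
    exact (hY0 t ht).antisymm
      ((antitoneOn_of_add_mul_rpow_le hc.le hY0 hY (mem_Ici.2 le_rfl) ht ht).trans h0.ge)
  · have hlin : Tendsto (fun t => c * β * (t - t₀) + Y t₀ ^ (-β)) atTop atTop :=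
      tendsto_atTop_add_const_right _ _
        ((tendsto_atTop_add_const_right _ (-t₀) tendsto_id).const_mul_atTop (by positivity))
    refine tendsto_of_tendsto_of_tendsto_of_le_of_le' tendsto_const_nhds
      ((tendsto_rpow_neg_atTop (y := 1 / β) (by positivity)).comp hlin) ?_ ?_
    · filter_upwards [eventually_ge_atTop t₀] with t ht using hY0 t ht
    · filter_upwards [eventually_ge_atTop t₀] with t ht
      exact le_rpow_of_add_mul_rpow_le hc hβ hY0 hYc hY hpos ht

end Decay

/-! ### Assembly of the theorem. -/

theorem mainTheorem2 {N : ℕ} (hN : 0 < N)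
    (Ω : Set (Eucl N)) (hΩo : IsOpen Ω) (hΩb : Bornology.IsBounded Ω)
    (h F : ℝ → ℝ) (hh : IsWeight h)
    (hFlip : LocallyLipschitzOn (Ici 0) F) (hFmono : MonotoneOn F (Ici 0))
    (γ₁ p : ℝ) (hγ : 0 < γ₁) (hp : γ₁ + 1 ≤ p)
    (hH : PowerDerivBoundedAbove (weightPrimitive h) γ₁)
    (hFH : ProductDerivBoundedBelow F (weightPrimitive h) γ₁)
    (M : ℝ) :
    ∃ c : ℝ, 0 < c ∧
      ∀ (t₀ : ℝ) (u₀ : Eucl N → ℝ) (u : ℝ → Eucl N → ℝ),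
        IsBoundedSolution Ω (weightPrimitive h) F t₀ u₀ M u →
        ∀ Y : ℝ → ℝ, Y = energyY Ω (weightPrimitive h) p u →
          (∀ t, t₀ ≤ t →
            IntegrableOn (fun x => weightPrimitive h (u t x) ^ (p + 1)) Ω) ∧
          (∀ T, t₀ ≤ T → AbsolutelyContinuousOnInterval Y t₀ T) ∧
          (∀ᵐ t ∂(volume.restrict (Ioi t₀)), DifferentiableAt ℝ Y t) ∧
          (∀ t, t₀ < t → DifferentiableAt ℝ Y t →
            deriv Y t + c * Y t ^ ((p + 1 + γ₁) / (p + 1)) ≤ 0) ∧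
          (Y t₀ = 0 → ∀ t, t₀ ≤ t → Y t = 0) ∧
          (0 < Y t₀ → ∀ t, t₀ ≤ t →
            Y t ≤ (c * (γ₁ / (p + 1)) * (t - t₀) + Y t₀ ^ (-(γ₁ / (p + 1))))
              ^ (-((p + 1) / γ₁))) ∧
          Tendsto Y atTop (𝓝 0) := by
  -- `M` may be nonpositive, whereas the structural hypotheses concern positive bounds.
  have hM : 0 < max M 1 := zero_lt_one.trans_le (le_max_right _ _)
  obtain ⟨c, hc, hE⟩ := exists_integral_rpow_mul_le (F := F) hN hΩb hh hγ hp hH hFH hM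
  have hp1 : 0 < p + 1 := by linarith
  have hp0 : 0 ≤ p := by linarith
  have hfin : IsFiniteMeasure (volume.restrict Ω) :=
    ⟨by rw [Measure.restrict_apply_univ]; exact hΩb.measure_lt_top⟩
  have hH0 : ∀ s, 0 ≤ s → 0 ≤ weightPrimitive h s := fun s hs => hh.weightPrimitive_nonneg hs
  -- The factor `p + 1` comes from differentiating `H(u)^(p+1)`.
  refine ⟨c * (p + 1), by positivity, fun t₀ u₀ u hu Y hYdef => ?_⟩
  obtain ⟨w, hw, hUw, hpde⟩ := hu.equation
  have hvM : ∀ t, t₀ < t → ∀ᵐ x ∂(volume.restrict Ω), u t x ≤ max M 1 := fun t ht => by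
    filter_upwards [hu.le_bound t ht] with x hx using hx.trans (le_max_left _ _)
  have hmono := hh.monotoneOn_weightPrimitive
  have hUm : AEStronglyMeasurable (fun x => weightPrimitive h (u t₀ x)) (volume.restrict Ω) := by
    have hcont : Continuous fun s => weightPrimitive h (max s 0) :=
      hh.continuousOn_weightPrimitive.comp_continuous (by fun_prop) fun s => le_max_right s 0
    refine (hcont.comp_aestronglyMeasurable (hu.measurable_slice t₀ le_rfl)).congr ?_
    filter_upwards [hu.nonneg t₀ le_rfl] with x hx
    simp only [max_eq_left hx]
  obtain ⟨hint, hwi, y, hyi, hyY, hyE⟩ := exists_integral_rpow_eq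
    (U := fun t x => weightPrimitive h (u t x)) (K := weightPrimitive h (max M 1))
    (e := p + 1) (by linarith) hw hUw hUm
    (fun t ht => by filter_upwards [hu.nonneg t ht] with x hx using hH0 _ hx)
    (fun t ht => by
      filter_upwards [hu.nonneg t ht.le, hvM t ht] with x h0 h1
      exact hmono h0 hM.le h1)
  have hYE : ∀ t, Y t = ∫ x in Ω, weightPrimitive h (u t x) ^ (p + 1) := fun t => by
    rw [hYdef]; rfl
  have hYy : ∀ t, t₀ ≤ t → Y t = Y t₀ + ∫ s in t₀..t, y s := fun t ht => by
    rw [hYE, hYE, hyY t ht]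
  have hY0 : ∀ t, t₀ ≤ t → 0 ≤ Y t := fun t ht => by
    rw [hYE]
    refine integral_nonneg_of_ae ?_
    filter_upwards [hu.nonneg t ht] with x hx using Real.rpow_nonneg (hH0 _ hx) _
  set θ := (p + 1 + γ₁) / (p + 1)
  have hθ : θ = 1 + γ₁ / (p + 1) := by simp only [θ]; field_simp
  have hβ : 0 < γ₁ / (p + 1) := by positivity
  have hyle : ∀ᵐ t ∂(volume.restrict (Ioi t₀)), y t ≤ -(c * (p + 1) * Y t ^ θ) := by
    filter_upwards [hpde, hwi, hyE, ae_restrict_mem measurableSet_Ioi] with t h1 h2 h3 ht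
    obtain ⟨hW, g, hg, hFg, hle⟩ := h1
    have hnn := hu.nonneg t (le_of_lt ht)
    have hE' := hE (u t) g hW hg hnn (hvM t ht) hFg
    have hUtm : AEStronglyMeasurable (fun x => weightPrimitive h (u t x) ^ p)
        (volume.restrict Ω) := by
      have hcont : Continuous fun s => weightPrimitive h (max s 0) ^ p :=
        (hh.continuousOn_weightPrimitive.comp_continuous (by fun_prop)
          fun s => le_max_right s 0).rpow_const fun _ => Or.inr hp0
      refine (hcont.comp_aestronglyMeasurable (hu.measurable_slice t (le_of_lt ht))).congr ?_
      filter_upwards [hnn] with x hx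
      simp only [max_eq_left hx]
    have hbd : ∀ᵐ x ∂(volume.restrict Ω),
        ‖weightPrimitive h (u t x) ^ p‖ ≤ weightPrimitive h (max M 1) ^ p := by
      filter_upwards [hnn, hvM t ht] with x h0 hx
      rw [Real.norm_of_nonneg (Real.rpow_nonneg (hH0 _ h0) _)]
      exact Real.rpow_le_rpow (hH0 _ h0) (hmono h0 hM.le hx) hp0
    have hmul : ∫ x in Ω, weightPrimitive h (u t x) ^ p * w t x ≤
        ∫ x in Ω, weightPrimitive h (u t x) ^ p * (F (u t x) * g x) := by
      refine integral_mono_ae (h2.bdd_mul hUtm hbd)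
        ((hFg.integrable (by norm_num)).bdd_mul hUtm hbd) ?_
      filter_upwards [hnn, hle] with x h0 hx
      exact mul_le_mul_of_nonneg_left (by linarith) (Real.rpow_nonneg (hH0 _ h0) _)
    rw [add_sub_cancel_right] at h3
    rw [h3, hYE t]
    have := mul_le_mul_of_nonneg_left (hmul.trans hE') hp1.le
    linarith
  have hcontY : ∀ T, t₀ ≤ T → AbsolutelyContinuousOnInterval Y t₀ T := fun T hT => by
    have hac := (hyi T hT).absolutelyContinuousOnInterval_intervalIntegral (c := t₀) left_mem_uIcc
    refine hac.of_dist_le (K := 1) fun a ha b hb => ?_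
    rw [uIcc_of_le hT] at ha hb
    rw [hYy a ha.1, hYy b hb.1, dist_add_left, one_mul]
  have hYc : ContinuousOn Y (Ici t₀) := fun t ht => by
    have ht' : t₀ ≤ t + 1 := le_trans ht (by linarith)
    have := (hcontY (t + 1) ht').continuousOn
    rw [uIcc_of_le ht'] at this
    refine (this t ⟨ht, by linarith⟩).mono_of_mem_nhdsWithin ?_
    rw [← Ici_inter_Iic]
    exact inter_mem self_mem_nhdsWithin (mem_nhdsWithin_of_mem_nhds (Iic_mem_nhds (by linarith)))
  have hsubint : ∀ a b, t₀ ≤ a → a ≤ b → Y b - Y a = ∫ s in a..b, y s := fun a b ha hab => by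
    rw [hYy a ha, hYy b (ha.trans hab), add_sub_add_left_eq_sub,
      intervalIntegral.integral_interval_sub_left (hyi b (ha.trans hab)) (hyi a ha)]
  have hyab : ∀ a b, t₀ ≤ a → a ≤ b → IntervalIntegrable y volume a b := fun a b ha hab =>
    (hyi a ha).symm.trans (hyi b (ha.trans hab))
  have hanti : AntitoneOn Y (Ici t₀) := fun a ha b hb hab => by
    have h1 := hsubint a b ha hab
    have h2 : ∫ s in a..b, y s ≤ ∫ s in a..b, (0 : ℝ) := by
      rw [intervalIntegral.integral_of_le hab, intervalIntegral.integral_of_le hab]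
      refine integral_mono_ae ((intervalIntegrable_iff_integrableOn_Ioc_of_le hab).1
        (hyab a b ha hab)) (integrable_zero _ _ _) ?_
      filter_upwards [ae_restrict_of_ae_restrict_of_subset
        (fun s hs => lt_of_le_of_lt ha hs.1) hyle, ae_restrict_mem measurableSet_Ioc] with s h3 h4
      refine h3.trans (neg_nonpos.2 (mul_nonneg (by positivity) (Real.rpow_nonneg (hY0 s ?_) _)))
      exact le_trans ha h4.1.le
    rw [intervalIntegral.integral_zero] at h2
    linarith
  -- Since `Y` decreases, `Y s ≥ Y b` on `[a,b]`, so the dissipation can be frozen at the right end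
  -- point when integrating.
  have hkey : ∀ a b, t₀ ≤ a → a ≤ b →
      Y b + c * (p + 1) * (b - a) * Y b ^ (1 + γ₁ / (p + 1)) ≤ Y a := fun a b ha hab => by
    have h1 := hsubint a b ha hab
    have h2 : ∫ s in a..b, y s ≤ ∫ s in a..b, -(c * (p + 1) * Y b ^ θ) := by
      rw [intervalIntegral.integral_of_le hab, intervalIntegral.integral_of_le hab]
      refine integral_mono_ae ((intervalIntegrable_iff_integrableOn_Ioc_of_le hab).1
        (hyab a b ha hab)) (integrable_const _) ?_
      filter_upwards [ae_restrict_of_ae_restrict_of_subset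
        (fun s hs => lt_of_le_of_lt ha hs.1) hyle, ae_restrict_mem measurableSet_Ioc] with s h3 h4
      refine h3.trans (neg_le_neg (mul_le_mul_of_nonneg_left ?_ (by positivity)))
      exact Real.rpow_le_rpow (hY0 b (ha.trans hab))
        (hanti (le_trans ha h4.1.le) (ha.trans hab) h4.2) (by rw [hθ]; positivity)
    rw [intervalIntegral.integral_const, smul_eq_mul, ← h1] at h2
    rw [← hθ]
    linarith
  have hc' : 0 < c * (p + 1) := by positivity
  refine ⟨hint, hcontY, ?_, fun t ht hd => ?_, fun h0 t ht => ?_, fun hpos t ht => ?_,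
    tendsto_zero_of_add_mul_rpow_le hc' hβ hY0 hYc hkey⟩
  · rw [ae_restrict_iff' measurableSet_Ioi]
    have hall : ∀ᵐ t : ℝ, ∀ n : ℕ, t ∈ uIcc t₀ (t₀ + n) → DifferentiableAt ℝ Y t := by
      rw [ae_all_iff]
      exact fun n => (hcontY (t₀ + n) (by linarith [n.cast_nonneg (α := ℝ)])).ae_differentiableAt
    filter_upwards [hall] with t ht htI
    obtain ⟨n, hn⟩ := exists_nat_ge (t - t₀)
    refine ht n ?_
    rw [uIcc_of_le (by linarith [n.cast_nonneg (α := ℝ)])]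
    exact ⟨le_of_lt htI, by linarith⟩
  · rw [hθ]
    exact deriv_add_mul_rpow_le hβ.le hkey ht hd
  · exact ((hanti (mem_Ici.2 le_rfl) ht ht).trans h0.le).antisymm (hY0 t ht)
  · have := le_rpow_of_add_mul_rpow_le hc' hβ hY0 hYc hkey hpos ht
    rwa [one_div_div] at this
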